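/- Let $\langle x,y\rangle=-x_0y_0+x_1y_1+x_2y_2+x_3y_3$ be the Lorentzian metric of $\mathbb R^{3,1}$, with flat connection $\nabla^{\mathbb R^{3,1}}$, and let $T_0$ be a constant unit time-like vector, $\langle T_0,T_0\rangle=-1$; a time-like vector $w$ is called future-directed if $\langle w,T_0\rangle<0$. Let $\Sigma$ be a closed (compact, without boundary) connected smooth surface and $X:\Sigma\to\mathbb R^{3,1}$ a smooth space-like immersion (for instance an embedding). Let $\nabla$, $\Delta$, $dv_\Sigma$ be the gradient, Laplace operator and area measure of the induced metric, $H_0$ the mean curvature vector (the trace of the second fundamental form $(\nabla^{\mathbb R^{3,1}}_{Y}Z)^\perp$), and $\tau=-\langle X,T_0\rangle$ the time function. For a space-like unit normal field $e_3$ along $\Sigma$ let $\alpha_{e_3}(Y)=\langle\nabla^{\mathbb R^{3,1}}_Y e_3,e_4\rangle$, where $e_4$ is the future-directed time-like unit normal orthogonal to $e_3$. Let $\widehat\Sigma$ be the projected surface $\widehat X=X-\tau T_0:\Sigma\to\mathbb R^3=T_0^\perp$, with area measure $dv_{\widehat\Sigma}$ (the integral over $\widehat\Sigma$ is taken along the parametrization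 $\widehat X$). Let $\hat\nu$ be a smooth unit normal field of $\widehat\Sigma$ in $\mathbb R^3$, let $\hat k$ be the mean curvature of $\widehat\Sigma$ with respect to $\hat\nu$ (the trace of $\langle\nabla_{\cdot}\hat\nu,\cdot\rangle$), and let $\breve e_3$ be $\hat\nu$ extended constantly along $T_0$, regarded as a normal field along $X(\Sigma)$. (i) For every such $\hat\nu$ (in particular for the outward one) $$\int_{\widehat\Sigma}\hat k\,dv_{\widehat\Sigma}=\int_\Sigma\Big[-\langle H_0,\breve e_3\rangle\sqrt{1+|\nabla\tau|^2}-\alpha_{\breve e_3}(\nabla\tau)\Big]dv_\Sigma .$$ (ii) If $\hat\nu$ is outward, i.e. $\widehat\Sigma$ is the boundary of a bounded open set $\Omega\subset\mathbb R^3$ and $\hat\nu$ points out of $\Omega$, and if $H_0$ is space-like everywhere ($\langle H_0,H_0\rangle>0$; $|H_0|=\sqrt{\langle H_0,H_0\rangle}$), then $$\int_{\widehat\Sigma}\hat k\,dv_{\widehat\Sigma}=\int_\Sigma\Big[\sqrt{(\Delta\tau)^2+|H_0|^2(1+|\nabla\tau|^2)}-\nabla\theta\cdot\nabla\tau-\alpha_{e_3^{H_0}}(\nabla\tau)\Big]dv_\Sigma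 ,$$ where $e_3^{H_0}=-H_0/|H_0|$ and $\theta$ is given by $\sinh\theta=\dfrac{-\Delta\tau}{|H_0|\sqrt{1+|\nabla\tau|^2}}$. -/

import Mathlib

open scoped Manifold ContDiff Topology
open MeasureTheory

namespace MinkowskiSurface

noncomputable section

/-- The vector space underlying Minkowski space `ℝ^{3,1}`; the index `0` is the time direction.
Only its topology and its Lorentzian form `lor` are used, never its norm. -/
abbrev Mink : Type := Fin 4 → ℝ

/-- The standard Lorentzian metric on `ℝ^{3,1}`, of signature `(-, +, +, +)`. -/
def lor (x y : Mink) : ℝ := -(x 0 * y 0) + x 1 * y 1 + x 2 * y 2 + x 3 * y 3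

/-- The model space of surfaces. -/
abbrev E2 : Type := EuclideanSpace ℝ (Fin 2)

/-- The coordinate vectors of the model space. As `TangentSpace 𝓘(ℝ, E2) p` is the model space, read
through the preferred chart at `p`, these are also the coordinate vectors of that chart at `p`. -/
def coordVec (i : Fin 2) : E2 := EuclideanSpace.single i 1

/-- The `i`-th partial derivative of a function on the model space. -/
def pd {V : Type*} [NormedAddCommGroup V] [NormedSpace ℝ V] (F : E2 → V) (i : Fin 2) (u : E2) : V :=
  fderiv ℝ F u (coordVec i)

section Surface

variable {M : Type*} [TopologicalSpace M] [ChartedSpace E2 M]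

/-- The differential at `p` of a map from the surface to a normed space. -/
def differential {V : Type*} [NormedAddCommGroup V] [NormedSpace ℝ V] (f : M → V) (p : M) :
    TangentSpace 𝓘(ℝ, E2) p →L[ℝ] V :=
  mfderiv 𝓘(ℝ, E2) 𝓘(ℝ, V) f p

/-- `X` is space-like: the symmetric form it induces on every tangent space of the surface is
positive definite. In particular a smooth space-like `X` is an immersion. -/
def IsSpacelike (X : M → Mink) : Prop :=
  ∀ (p : M) (v : TangentSpace 𝓘(ℝ, E2) p), v ≠ 0 →
    0 < lor (differential X p v) (differential X p v)

/-- A map on the surface, expressed in the preferred chart at `p`. -/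
def localRep {V : Type*} (f : M → V) (p : M) : E2 → V :=
  f ∘ (extChartAt 𝓘(ℝ, E2) p).symm

/-- The coordinates of `p` in the preferred chart at `p`. -/
def center (p : M) : E2 := extChartAt 𝓘(ℝ, E2) p p

/-! ### The metric induced by a space-like map, and its differential operators -/

/-- The coefficients `g_{ij}` of the induced metric of `X`, in the preferred chart at `p`, at the
point with coordinates `u`. -/
def gram (X : M → Mink) (p : M) (u : E2) : Matrix (Fin 2) (Fin 2) ℝ :=
  Matrix.of fun i j => lor (pd (localRep X p) i u) (pd (localRep X p) j u)

/-- The coefficients `g^{ij}` at `p` of the inverse of the induced metric of `X`, in the preferred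
chart at `p`. -/
def invGram (X : M → Mink) (p : M) : Matrix (Fin 2) (Fin 2) ℝ := (gram X p (center p))⁻¹

/-- The inner product of tangent vectors in the induced metric of `X`. -/
def dot (X : M → Mink) (p : M) (v w : TangentSpace 𝓘(ℝ, E2) p) : ℝ :=
  lor (differential X p v) (differential X p w)

/-- The gradient `∇ f = g^{ij} ∂_j f ∂_i` in the induced metric of `X`. -/
def gradient (X : M → Mink) (f : M → ℝ) (p : M) : TangentSpace 𝓘(ℝ, E2) p :=
  ∑ i, ∑ j, (invGram X p i j * differential f p (coordVec j)) • coordVec i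

/-- The Christoffel symbol `Γ^k_{ij}` at `p` of the induced metric of `X`, in the preferred chart at
`p`. -/
def christoffel (X : M → Mink) (p : M) (k i j : Fin 2) : ℝ :=
  (1 / 2) * ∑ l, invGram X p k l *
    (pd (fun u => gram X p u j l) i (center p) + pd (fun u => gram X p u i l) j (center p)
      - pd (fun u => gram X p u i j) l (center p))

/-- The Laplace operator of the induced metric of `X`, the trace of the Hessian:
`Δ f = g^{ij} (∂_i ∂_j f - Γ^k_{ij} ∂_k f)`. -/
def laplacian (X : M → Mink) (f : M → ℝ) (p : M) : ℝ :=
  ∑ i, ∑ j, invGram X p i j *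
    (pd (pd (localRep f p) j) i (center p)
      - ∑ k, christoffel X p k i j * pd (localRep f p) k (center p))

/-- The area measure of the induced metric of `X`. On the domain of the preferred chart at `p` it is
`√(det g_{ij}) du¹ du²`; these measures agree on overlaps of charts, and their supremum is the
measure which restricts to each of them. -/
def area [MeasurableSpace M] (X : M → Mink) : Measure M :=
  ⨆ p : M, Measure.map (extChartAt 𝓘(ℝ, E2) p).symm
    ((volume.restrict (extChartAt 𝓘(ℝ, E2) p).target).withDensity
      fun u => ENNReal.ofReal (Real.sqrt (gram X p u).det))

/-! ### Extrinsic geometry in Minkowski space -/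

/-- The component of `y` normal to the surface at `p`. -/
def normalPart (X : M → Mink) (p : M) (y : Mink) : Mink :=
  y - ∑ i, ∑ j, (invGram X p i j * lor y (differential X p (coordVec i))) •
    differential X p (coordVec j)

/-- The second fundamental form `II(∂_i, ∂_j) = (∂_i ∂_j X)^⊥` at `p`. -/
def secondFundamentalForm (X : M → Mink) (p : M) (i j : Fin 2) : Mink :=
  normalPart X p (pd (pd (localRep X p) j) i (center p))

/-- The mean curvature vector, the trace of the second fundamental form. -/
def meanCurvatureVector (X : M → Mink) (p : M) : Mink :=
  ∑ i, ∑ j, invGram X p i j • secondFundamentalForm X p i j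

/-- `w` is a time-like unit normal of the surface at `p`, orthogonal to `e`, and future-directed for
the time orientation of the time-like vector `T₀`. -/
def IsFutureUnitNormal (T₀ : Mink) (X : M → Mink) (p : M) (e w : Mink) : Prop :=
  lor w w = -1 ∧ (∀ v : TangentSpace 𝓘(ℝ, E2) p, lor w (differential X p v) = 0) ∧
    lor w e = 0 ∧ lor w T₀ < 0

/-- For a space-like unit normal field `e₃`, the (unique) future-directed time-like unit normal `e₄`
orthogonal to `e₃`. -/
def futureNormal (T₀ : Mink) (X : M → Mink) (e₃ : M → Mink) (p : M) : Mink :=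
  Classical.epsilon (IsFutureUnitNormal T₀ X p (e₃ p))

/-- The connection form `α_{e₃}(v) = ⟨∇_v e₃, e₄⟩` of the normal bundle determined by the space-like
unit normal field `e₃`, where `∇` is the flat connection of Minkowski space. -/
def connForm (T₀ : Mink) (X : M → Mink) (e₃ : M → Mink) (p : M)
    (v : TangentSpace 𝓘(ℝ, E2) p) : ℝ :=
  lor (differential e₃ p v) (futureNormal T₀ X e₃ p)

/-! ### The time function and the projection along `T₀` -/

/-- The restriction `τ = -⟨X, T₀⟩` of the time function associated with `T₀`. -/
def timeFun (T₀ : Mink) (X : M → Mink) (p : M) : ℝ := -lor (X p) T₀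

/-- The projection `X - τ T₀` of `X` to the orthogonal complement of `T₀`, for a unit time-like
`T₀`. -/
def proj (T₀ : Mink) (X : M → Mink) (p : M) : Mink := X p - timeFun T₀ X p • T₀

/-- The Euclidean three-space `ℝ³ = T₀^⊥`; its Euclidean inner product is the restriction of
`lor`. -/
def spaceSlice (T₀ : Mink) : Submodule ℝ Mink where
  carrier := {x | lor x T₀ = 0}
  add_mem' := by
    intro a b ha hb
    simp only [Set.mem_ofPred_eq, lor, Pi.add_apply] at *
    linarith
  zero_mem' := by simp [lor]
  smul_mem' := by
    intro c x hx
    simp only [Set.mem_ofPred_eq, lor, Pi.smul_apply, smul_eq_mul] at *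
    linear_combination c * hx

/-- `ν` is a smooth unit normal field, in the Euclidean space `T₀^⊥`, of the projected surface. -/
structure IsUnitNormalOfProj (T₀ : Mink) (X : M → Mink) (ν : M → Mink) : Prop where
  smooth : ContMDiff 𝓘(ℝ, E2) 𝓘(ℝ, Mink) ∞ ν
  mem_slice : ∀ p, ν p ∈ spaceSlice T₀
  unit : ∀ p, lor (ν p) (ν p) = 1
  normal : ∀ (p : M) (v : TangentSpace 𝓘(ℝ, E2) p), lor (ν p) (differential (proj T₀ X) p v) = 0

/-- `ν` is outward: the projected surface is the boundary in `T₀^⊥` of a bounded open set `Ω`, and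
`ν` points out of `Ω`. -/
def IsOutward (T₀ : Mink) (X : M → Mink) (ν : M → Mink) : Prop :=
  ∃ Ω : Set (spaceSlice T₀), IsOpen Ω ∧ Bornology.IsBounded Ω ∧
    frontier Ω = {y : spaceSlice T₀ | (y : Mink) ∈ Set.range (proj T₀ X)} ∧
    ∀ p : M, ∀ᶠ t : ℝ in 𝓝[>] 0,
      (∃ y ∈ Ω, (y : Mink) = proj T₀ X p - t • ν p) ∧
      ∃ y ∉ closure Ω, (y : Mink) = proj T₀ X p + t • ν p

/-- The mean curvature `k̂ = ĝ^{ij} ⟨∂_i ν, ∂_j X̂⟩` in `T₀^⊥` of the projected surface `X̂` with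
respect to its unit normal `ν`, the trace of `⟨∇ν, ·⟩` in the induced metric `ĝ` of `X̂`. -/
def projMeanCurvature (T₀ : Mink) (X : M → Mink) (ν : M → Mink) (p : M) : ℝ :=
  ∑ i, ∑ j, invGram (proj T₀ X) p i j *
    lor (differential ν p (coordVec i)) (differential (proj T₀ X) p (coordVec j))

/-! ### The frame determined by a space-like mean curvature vector -/

/-- The Lorentzian length `|H₀|` of the mean curvature vector, where it is space-like. -/
def normH (X : M → Mink) (p : M) : ℝ :=
  Real.sqrt (lor (meanCurvatureVector X p) (meanCurvatureVector X p))

/-- The space-like unit normal field `e₃ = -H₀ / |H₀|`. -/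
def e3H (X : M → Mink) (p : M) : Mink := -((normH X p)⁻¹ • meanCurvatureVector X p)

/-- `1 + |∇ τ|²`. -/
def lapse (T₀ : Mink) (X : M → Mink) (p : M) : ℝ :=
  1 + dot X p (gradient X (timeFun T₀ X) p) (gradient X (timeFun T₀ X) p)

/-- The function `θ` with `sinh θ = -Δ τ / (|H₀| √(1 + |∇ τ|²))`. -/
def angle (T₀ : Mink) (X : M → Mink) (p : M) : ℝ :=
  Real.arsinh (-laplacian X (timeFun T₀ X) p / (normH X p * Real.sqrt (lapse T₀ X p)))

end Surface

end

end MinkowskiSurface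

/-! Both identities hold pointwise once the two area measures are compared, so nothing is integrated
by parts and integrability plays no role.

Let g be the induced metric and L = 1 + |∇τ|². Projection along the unit time-like T₀ changes g into
ĝ = g + dτ ⊗ dτ. Hence the projected area measure is √L times the original one (`area_proj`), and
ĝ⁻¹ = g⁻¹ − L⁻¹ ∇τ ⊗ ∇τ. Since ν is orthogonal to the constant T₀, so is its derivative, and the
form h(v, w) = ⟨∇_v ν, w⟩ is the same for both surfaces. Its ĝ-trace is k̂ and its g-trace is −⟨H₀,
ν⟩, so L k̂ = −L⟨H₀, ν⟩ − h(∇τ, ∇τ) (`projMeanCurvature_mul_lapse`). The future unit normal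
orthogonal to ν is w = (T₀ + ∇τ)/√L, which gives h(∇τ, ∇τ) = √L α_ν(∇τ). Dividing by √L and
integrating proves (i).

For (ii), expand H₀ in the orthonormal normal frame (ν, w): |H₀|² = ⟨H₀, ν⟩² − ⟨H₀, w⟩², while ΔX =
H₀ gives Δτ = −√L ⟨H₀, w⟩. Therefore (Δτ)² + |H₀|² L = L⟨H₀, ν⟩², and the square root is −√L ⟨H₀, ν⟩
as soon as ⟨H₀, ν⟩ < 0. This function has no zero, because H₀ is space-like, and Σ is connected, so
one point decides its sign: a point of the projected surface farthest from the origin, where an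
outward normal makes h positive definite (`exists_lor_meanCurvatureVector_neg`). Finally −H₀/|H₀| is
the boost of ν by the angle θ in the plane of ν and w, and a boost changes the connection form by
−dθ (`connForm_e3H`), which the term ∇θ·∇τ compensates. -/

namespace MinkowskiSurface

/-! ### Algebra of the Lorentzian form -/

theorem lor_comm (x y : Mink) : lor x y = lor y x := by simp only [lor]; ring

theorem lor_add_left (x y z : Mink) : lor (x + y) z = lor x z + lor y z := by
  simp only [lor, Pi.add_apply]; ring

theorem lor_add_right (x y z : Mink) : lor x (y + z) = lor x y + lor x z := by
  simp only [lor, Pi.add_apply]; ring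

theorem lor_sub_left (x y z : Mink) : lor (x - y) z = lor x z - lor y z := by
  simp only [lor, Pi.sub_apply]; ring

theorem lor_sub_right (x y z : Mink) : lor x (y - z) = lor x y - lor x z := by
  simp only [lor, Pi.sub_apply]; ring

theorem lor_neg_left (x y : Mink) : lor (-x) y = -lor x y := by
  simp only [lor, Pi.neg_apply]; ring

theorem lor_neg_right (x y : Mink) : lor x (-y) = -lor x y := by
  simp only [lor, Pi.neg_apply]; ring

theorem lor_smul_left (c : ℝ) (x y : Mink) : lor (c • x) y = c * lor x y := by
  simp only [lor, Pi.smul_apply, smul_eq_mul]; ring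

theorem lor_smul_right (c : ℝ) (x y : Mink) : lor x (c • y) = c * lor x y := by
  simp only [lor, Pi.smul_apply, smul_eq_mul]; ring

theorem lor_zero_left (x : Mink) : lor 0 x = 0 := by simp [lor]

theorem lor_zero_right (x : Mink) : lor x 0 = 0 := by simp [lor]

/-- The Lorentzian metric as a continuous bilinear map. -/
noncomputable def lorL : Mink →L[ℝ] Mink →L[ℝ] ℝ :=
  LinearMap.toContinuousBilinearMap
    (LinearMap.mk₂ ℝ lor lor_add_left lor_smul_left lor_add_right lor_smul_right)

theorem lorL_apply (x y : Mink) : lorL x y = lor x y := by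
  simp [lorL]

theorem eq_zero_of_lor_eq_zero {z : Mink} (h : ∀ y, lor y z = 0) : z = 0 := by
  ext i
  have := h (Pi.single i 1)
  fin_cases i <;> simpa [lor] using this

/-- A vector orthogonal to a frame consisting of two vectors with nondegenerate Gram matrix and two
orthonormal vectors normal to them vanishes. -/
theorem eq_zero_of_orthogonal_frame {a b e w z : Mink}
    (hD : lor a a * lor b b - lor a b * lor a b ≠ 0)
    (hae : lor e a = 0) (hbe : lor e b = 0) (haw : lor w a = 0) (hbw : lor w b = 0)
    (hew : lor w e = 0) (hee : lor e e = 1) (hww : lor w w = -1)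
    (za : lor a z = 0) (zb : lor b z = 0) (ze : lor e z = 0) (zw : lor w z = 0) : z = 0 := by
  have hli : LinearIndependent ℝ ![a, b, e, w] := by
    rw [Fintype.linearIndependent_iff]
    intro c hc
    simp only [Fin.sum_univ_four, Matrix.cons_val] at hc
    have key : ∀ y, c 0 * lor a y + c 1 * lor b y + c 2 * lor e y + c 3 * lor w y = 0 := by
      intro y
      have := congrArg (fun x => lor x y) hc
      simpa only [lor_add_left, lor_smul_left, lor_zero_left] using this
    have k0 := key a
    have k1 := key b
    have k2 := key e
    have k3 := key w
    rw [lor_comm a e, lor_comm b e, hae, hbe, hee, hew] at k2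
    rw [lor_comm a w, lor_comm b w, lor_comm e w, haw, hbw, hew, hww] at k3
    have c2 : c 2 = 0 := by linarith
    have c3 : c 3 = 0 := by linarith
    rw [lor_comm b a, c2, c3] at k0
    rw [c2, c3] at k1
    have c0 : c 0 = 0 := by
      have : c 0 * (lor a a * lor b b - lor a b * lor a b) = 0 := by
        linear_combination lor b b * k0 - lor a b * k1
      exact (mul_eq_zero.mp this).resolve_right hD
    have c1 : c 1 = 0 := by
      have : c 1 * (lor a a * lor b b - lor a b * lor a b) = 0 := by
        linear_combination lor a a * k1 - lor a b * k0
      exact (mul_eq_zero.mp this).resolve_right hD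
    intro i
    fin_cases i <;> assumption
  -- Four independent vectors span, so z is orthogonal to every vector and the nondegeneracy of the
  -- form applies.
  have htop := hli.span_eq_top_of_card_eq_finrank (by simp)
  refine eq_zero_of_lor_eq_zero fun y => ?_
  have hy : y ∈ Submodule.span ℝ (Set.range ![a, b, e, w]) := htop ▸ Submodule.mem_top
  induction hy using Submodule.span_induction with
  | mem x hx =>
    obtain ⟨i, rfl⟩ := hx
    fin_cases i <;> assumption
  | zero => exact lor_zero_left z
  | add x y _ _ hx hy => rw [lor_add_left, hx, hy, add_zero]
  | smul c x _ hx => rw [lor_smul_left, hx, mul_zero]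

/-! ### Two-by-two matrices -/

/-- No invertibility is needed: for a singular matrix the inverse and the quotients by `G.det` are
all zero by convention. -/
theorem inv_fin_two_apply (G : Matrix (Fin 2) (Fin 2) ℝ) :
    G⁻¹ 0 0 = G 1 1 / G.det ∧ G⁻¹ 0 1 = -G 0 1 / G.det ∧ G⁻¹ 1 0 = -G 1 0 / G.det ∧
      G⁻¹ 1 1 = G 0 0 / G.det := by
  rw [Matrix.inv_def, Matrix.adjugate_fin_two, Ring.inverse_eq_inv']
  simp only [Matrix.smul_apply, smul_eq_mul, Matrix.of_apply, Matrix.cons_val', Matrix.cons_val]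
  refine ⟨?_, ?_, ?_, ?_⟩ <;> ring

theorem sum_inv_mul (G B : Matrix (Fin 2) (Fin 2) ℝ) :
    ∑ i, ∑ j, G⁻¹ i j * B i j
      = (G 1 1 * B 0 0 - G 0 1 * B 0 1 - G 1 0 * B 1 0 + G 0 0 * B 1 1) / G.det := by
  obtain ⟨h0, h1, h2, h3⟩ := inv_fin_two_apply G
  simp only [Fin.sum_univ_two, h0, h1, h2, h3]
  ring

/-- The trace of one bilinear form with respect to another does not depend on the basis. -/
theorem sum_inv_mul_basis_change (G B A : Matrix (Fin 2) (Fin 2) ℝ) (hA : A.det ≠ 0) :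
    ∑ i, ∑ j, (A.transpose * G * A)⁻¹ i j * (A.transpose * B * A) i j
      = ∑ i, ∑ j, G⁻¹ i j * B i j := by
  rw [sum_inv_mul, sum_inv_mul, Matrix.det_mul, Matrix.det_mul, Matrix.det_transpose,
    ← mul_div_mul_left _ G.det (mul_ne_zero hA hA)]
  congr 1
  · simp only [Matrix.mul_apply, Fin.sum_univ_two, Matrix.transpose_apply, Matrix.det_fin_two]
    ring
  · ring

/-! ### Calculus in charts -/

section Calculus

variable {M : Type*} [TopologicalSpace M] [ChartedSpace E2 M]
  {V : Type*} [NormedAddCommGroup V] [NormedSpace ℝ V]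
  {W : Type*} [NormedAddCommGroup W] [NormedSpace ℝ W]

theorem differential_eq_fderiv {f : M → V} {p : M}
    (hf : MDifferentiableAt 𝓘(ℝ, E2) 𝓘(ℝ, V) f p) :
    differential f p = fderiv ℝ (localRep f p) (center p) := by
  unfold differential
  rw [hf.mfderiv]
  simp only [ModelWithCorners.range_eq_univ, fderivWithin_univ]
  rfl

theorem differentiableAt_localRep_center {f : M → V} {p : M}
    (hf : MDifferentiableAt 𝓘(ℝ, E2) 𝓘(ℝ, V) f p) :
    DifferentiableAt ℝ (localRep f p) (center p) := by
  have := hf.differentiableWithinAt_writtenInExtChartAt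
  simp only [ModelWithCorners.range_eq_univ, differentiableWithinAt_univ] at this
  exact this

theorem localRep_center {Z : Type*} (f : M → Z) (p : M) : localRep f p (center p) = f p := by
  simp [localRep, center]

theorem differential_const (c : V) (p : M) (v : TangentSpace 𝓘(ℝ, E2) p) :
    differential (fun _ : M => c) p v = 0 := by
  have : differential (fun _ : M => c) p = 0 := mfderiv_const
  rw [this]; rfl

theorem differential_bilinear {U : Type*} [NormedAddCommGroup U] [NormedSpace ℝ U]
    (B : V →L[ℝ] W →L[ℝ] U) {f : M → V} {g : M → W} {p : M}
    (hf : MDifferentiableAt 𝓘(ℝ, E2) 𝓘(ℝ, V) f p) (hg : MDifferentiableAt 𝓘(ℝ, E2) 𝓘(ℝ, W) g p)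
    (v : TangentSpace 𝓘(ℝ, E2) p) :
    differential (fun q => B (f q) (g q)) p v
      = B (differential f p v) (g p) + B (f p) (differential g p v) := by
  have hB : MDifferentiableAt 𝓘(ℝ, E2) 𝓘(ℝ, U) (fun q => B (f q) (g q)) p :=
    ((B.differentiable.differentiableAt.comp_mdifferentiableAt hf).clm_apply hg)
  rw [differential_eq_fderiv hB, differential_eq_fderiv hf, differential_eq_fderiv hg]
  have h := B.hasFDerivAt_of_bilinear (differentiableAt_localRep_center hf).hasFDerivAt
    (differentiableAt_localRep_center hg).hasFDerivAt
  have e : localRep (fun q => B (f q) (g q)) p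
    = fun u => B (localRep f p u) (localRep g p u) := rfl
  rw [e, h.fderiv, localRep_center, localRep_center]
  exact add_comm (B (f p) (fderiv ℝ (localRep g p) (center p) v))
    (B (fderiv ℝ (localRep f p) (center p) v) (g p))

theorem differential_lor {f g : M → Mink} {p : M}
    (hf : MDifferentiableAt 𝓘(ℝ, E2) 𝓘(ℝ, Mink) f p)
    (hg : MDifferentiableAt 𝓘(ℝ, E2) 𝓘(ℝ, Mink) g p) (v : TangentSpace 𝓘(ℝ, E2) p) :
    differential (fun q => lor (f q) (g q)) p v
      = lor (differential f p v) (g p) + lor (f p) (differential g p v) := by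
  simpa only [lorL_apply] using differential_bilinear lorL hf hg v

theorem differential_smul {c : M → ℝ} {f : M → V} {p : M}
    (hc : MDifferentiableAt 𝓘(ℝ, E2) 𝓘(ℝ, ℝ) c p) (hf : MDifferentiableAt 𝓘(ℝ, E2) 𝓘(ℝ, V) f p)
    (v : TangentSpace 𝓘(ℝ, E2) p) :
    differential (fun q => c q • f q) p v
      = differential c p v • f p + c p • differential f p v := by
  simpa using differential_bilinear (ContinuousLinearMap.lsmul ℝ ℝ) hc hf v

theorem differential_add {f g : M → V} {p : M}
    (hf : MDifferentiableAt 𝓘(ℝ, E2) 𝓘(ℝ, V) f p) (hg : MDifferentiableAt 𝓘(ℝ, E2) 𝓘(ℝ, V) g p)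
    (v : TangentSpace 𝓘(ℝ, E2) p) :
    differential (fun q => f q + g q) p v = differential f p v + differential g p v := by
  unfold differential
  have := mfderiv_add hf hg
  exact congrArg (fun L => L v) this

theorem differential_comp_real {φ : ℝ → ℝ} {f : M → ℝ} {p : M} {φ' : ℝ}
    (hφ : HasDerivAt φ φ' (f p)) (hf : MDifferentiableAt 𝓘(ℝ, E2) 𝓘(ℝ, ℝ) f p)
    (v : TangentSpace 𝓘(ℝ, E2) p) :
    differential (fun q => φ (f q)) p v = φ' * differential f p v := by
  have hc : MDifferentiableAt 𝓘(ℝ, E2) 𝓘(ℝ, ℝ) (fun q => φ (f q)) p :=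
    hφ.differentiableAt.comp_mdifferentiableAt hf
  rw [differential_eq_fderiv hc, differential_eq_fderiv hf]
  have e : localRep (fun q => φ (f q)) p = φ ∘ (localRep f p) := rfl
  rw [← localRep_center f p] at hφ
  rw [e, (hφ.comp_hasFDerivAt _ (differentiableAt_localRep_center hf).hasFDerivAt).fderiv]
  rfl

theorem contMDiff_lor {f g : M → Mink} (hf : ContMDiff 𝓘(ℝ, E2) 𝓘(ℝ, Mink) ∞ f)
    (hg : ContMDiff 𝓘(ℝ, E2) 𝓘(ℝ, Mink) ∞ g) :
    ContMDiff 𝓘(ℝ, E2) 𝓘(ℝ, ℝ) ∞ (fun q => lor (f q) (g q)) := by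
  simp only [← lorL_apply]
  exact (lorL.contDiff.comp_contMDiff hf).clm_apply hg

theorem contMDiff_mink {f : M → Mink} :
    ContMDiff 𝓘(ℝ, E2) 𝓘(ℝ, Mink) ∞ f ↔ ∀ k, ContMDiff 𝓘(ℝ, E2) 𝓘(ℝ, ℝ) ∞ (fun q => f q k) :=
  contMDiff_pi_space

theorem differential_apply {f : M → Mink} {p : M}
    (hf : MDifferentiableAt 𝓘(ℝ, E2) 𝓘(ℝ, Mink) f p) (k : Fin 4)
    (v : TangentSpace 𝓘(ℝ, E2) p) :
    differential (fun q => f q k) p v = differential f p v k := by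
  have hk : MDifferentiableAt 𝓘(ℝ, E2) 𝓘(ℝ, ℝ) (fun q => f q k) p :=
    (ContinuousLinearMap.proj (R := ℝ) (φ := fun _ : Fin 4 => ℝ)
      k).differentiableAt.comp_mdifferentiableAt hf
  rw [differential_eq_fderiv hf, differential_eq_fderiv hk]
  have := (hasFDerivAt_pi'.mp (differentiableAt_localRep_center hf).hasFDerivAt k).fderiv
  exact congrArg (fun L => L v) this

theorem pd_center {f : M → V} {p : M} (hf : MDifferentiableAt 𝓘(ℝ, E2) 𝓘(ℝ, V) f p) (i : Fin 2) :
    pd (localRep f p) i (center p) = differential f p (coordVec i) := by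
  rw [differential_eq_fderiv hf]; rfl

theorem center_mem_target (p : M) : center p ∈ (extChartAt 𝓘(ℝ, E2) p).target :=
  mem_extChartAt_target p

variable [IsManifold 𝓘(ℝ, E2) ∞ M]

theorem contDiffAt_localRep {f : M → V} (hf : ContMDiff 𝓘(ℝ, E2) 𝓘(ℝ, V) ∞ f) {p : M} {u : E2}
    (hu : u ∈ (extChartAt 𝓘(ℝ, E2) p).target) : ContDiffAt ℝ ∞ (localRep f p) u := by
  rw [← contMDiffAt_iff_contDiffAt]
  have h := (contMDiffOn_extChartAt_symm (I := 𝓘(ℝ, E2)) (n := ∞) p).contMDiffAt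
    ((isOpen_extChartAt_target (I := 𝓘(ℝ, E2)) p).mem_nhds hu)
  exact hf.contMDiffAt.comp u h

theorem contDiffAt_pd {F : E2 → V} {u : E2} (hF : ContDiffAt ℝ ∞ F u) (i : Fin 2) :
    ContDiffAt ℝ ∞ (pd F i) u :=
  (hF.fderiv_right (m := ∞) (by simp)).clm_apply contDiffAt_const

/-- The differential of the inverse of a chart. -/
noncomputable def chartFrame (p : M) (u : E2) :
    E2 →L[ℝ] TangentSpace 𝓘(ℝ, E2) ((extChartAt 𝓘(ℝ, E2) p).symm u) :=
  mfderiv 𝓘(ℝ, E2) 𝓘(ℝ, E2) (extChartAt 𝓘(ℝ, E2) p).symm u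

/-- The chain rule. It carries facts stated in the preferred chart of each point over to a
neighbourhood in one fixed chart, where they can be differentiated. -/
theorem fderiv_localRep {f : M → V} (hf : ContMDiff 𝓘(ℝ, E2) 𝓘(ℝ, V) ∞ f) {p : M} {u : E2}
    (hu : u ∈ (extChartAt 𝓘(ℝ, E2) p).target) (v : E2) :
    fderiv ℝ (localRep f p) u v
      = differential f ((extChartAt 𝓘(ℝ, E2) p).symm u) (chartFrame p u v) := by
  rw [← mfderiv_eq_fderiv]
  have h := ((contMDiffOn_extChartAt_symm (I := 𝓘(ℝ, E2)) (n := ∞) p).contMDiffAt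
    ((isOpen_extChartAt_target (I := 𝓘(ℝ, E2)) p).mem_nhds hu)).mdifferentiableAt (by simp)
  have := mfderiv_comp u ((hf _).mdifferentiableAt (by simp)) h
  unfold localRep
  rw [this]
  rfl

theorem chartFrame_injective {p : M} {u : E2} (hu : u ∈ (extChartAt 𝓘(ℝ, E2) p).target) :
    Function.Injective (chartFrame p u) := by
  have h := isInvertible_mfderivWithin_extChartAt_symm (I := 𝓘(ℝ, E2)) hu
  rw [ModelWithCorners.range_eq_univ, mfderivWithin_univ] at h
  exact h.injective

end Calculus

/-! ### The induced metric and changes of charts -/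

section Metric

variable {M : Type*} [TopologicalSpace M] [ChartedSpace E2 M]

theorem eq_sum_coordVec (w : E2) : w = w 0 • coordVec 0 + w 1 • coordVec 1 := by
  ext i
  fin_cases i <;> simp [coordVec]

theorem differential_eq_sum {V : Type*} [NormedAddCommGroup V] [NormedSpace ℝ V] (f : M → V) (p : M)
    (w : E2) :
    differential f p w
      = w 0 • differential f p (coordVec 0) + w 1 • differential f p (coordVec 1) := by
  have h : ∀ L : E2 →L[ℝ] V, L w = w 0 • L (coordVec 0) + w 1 • L (coordVec 1) := by
    intro L
    conv_lhs => rw [eq_sum_coordVec w]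
    rw [map_add, map_smul, map_smul]
  exact h (differential f p)

/-- The matrix of a linear endomorphism of the model space in the coordinate basis. -/
noncomputable def coordMatrix (A : E2 → E2) : Matrix (Fin 2) (Fin 2) ℝ := Matrix.of fun k i
    => A (coordVec i) k

theorem det_coordMatrix_ne_zero (A : E2 →L[ℝ] E2) (hA : Function.Injective A) :
    (coordMatrix A).det ≠ 0 := by
  intro h
  obtain ⟨v, hv, hv0⟩ := Matrix.exists_mulVec_eq_zero_iff.mpr h
  have h1 : A (v 0 • coordVec 0 + v 1 • coordVec 1) = 0 := by
    rw [map_add, map_smul, map_smul]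
    ext k
    have := congrFun hv0 k
    simp only [Matrix.mulVec, dotProduct, Fin.sum_univ_two, coordMatrix, Matrix.of_apply,
      Pi.zero_apply] at this
    simp only [PiLp.add_apply, PiLp.smul_apply, smul_eq_mul, PiLp.zero_apply]
    linarith
  have h2 := hA (h1.trans (map_zero A).symm)
  refine hv (funext fun i => ?_)
  have := congrArg (fun w : E2 => w i) h2
  fin_cases i <;> simpa [coordVec] using this

theorem gram_center {X : M → Mink} {p : M} (hX : MDifferentiableAt 𝓘(ℝ, E2) 𝓘(ℝ, Mink) X p)
    (i j : Fin 2) :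
    gram X p (center p) i j
      = lor (differential X p (coordVec i)) (differential X p (coordVec j)) := by
  simp only [gram, Matrix.of_apply, pd_center hX]

theorem gram_symm (X : M → Mink) (p : M) (u : E2) (i j : Fin 2) :
    gram X p u i j = gram X p u j i := by
  simp only [gram, Matrix.of_apply, lor_comm]

theorem det_gram (X : M → Mink) (p : M) (u : E2) :
    (gram X p u).det = gram X p u 0 0 * gram X p u 1 1 - gram X p u 0 1 * gram X p u 0 1 := by
  rw [Matrix.det_fin_two, gram_symm X p u 1 0]

theorem gram_center_pos {X : M → Mink} (hX : ContMDiff 𝓘(ℝ, E2) 𝓘(ℝ, Mink) ∞ X)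
    (hs : IsSpacelike X) (p : M) :
    0 < gram X p (center p) 0 0 ∧ 0 < (gram X p (center p)).det := by
  have hd := (hX p).mdifferentiableAt (by simp)
  have h0 : 0 < gram X p (center p) 0 0 := by
    rw [gram_center hd]
    refine hs p (coordVec 0) fun h => one_ne_zero (α := ℝ) ?_
    have : (coordVec 0) 0 = (0 : E2) 0 := congrArg (fun w : E2 => w 0) h
    simp [coordVec] at this
  refine ⟨h0, ?_⟩
  rw [det_gram]
  set g00 := gram X p (center p) 0 0 with e00
  set g01 := gram X p (center p) 0 1 with e01
  set g11 := gram X p (center p) 1 1 with e11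
  -- The Gram–Schmidt vector −g₀₁∂₀ + g₀₀∂₁ has square length g₀₀ det g.
  have hv := hs p (-g01 • coordVec 0 + g00 • coordVec 1 : E2) (by
    intro h
    have := congrArg (fun w : E2 => w 1) h
    simp [coordVec] at this
    exact h0.ne' this)
  rw [differential_eq_sum X p] at hv
  simp only [coordVec, PiLp.add_apply, PiLp.smul_apply, smul_eq_mul, PiLp.single_apply] at hv
  norm_num at hv
  simp only [lor_add_left, lor_add_right, lor_smul_left, lor_smul_right, lor_neg_left,
    lor_neg_right] at hv
  have i00 := e00.trans (gram_center hd 0 0)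
  have i01 := e01.trans (gram_center hd 0 1)
  have i10 := e01.trans ((gram_symm X p _ 0 1).trans (gram_center hd 1 0))
  have i11 := e11.trans (gram_center hd 1 1)
  unfold coordVec at i00 i01 i10 i11
  rw [← i00, ← i01, ← i10, ← i11] at hv
  have : 0 < g00 * (g00 * g11 - g01 * g01) := by linarith
  exact pos_of_mul_pos_right this h0.le |>.trans_le le_rfl

/-- The inner product `g^{ij} ∂_i f ∂_j h` of the gradients of two functions. -/
noncomputable def gradDot (X : M → Mink) (f h : M → ℝ) (p : M) : ℝ :=
  ∑ i, ∑ j, invGram X p i j * (differential f p (coordVec i) * differential h p (coordVec j))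

theorem invGram_symm (X : M → Mink) (p : M) : invGram X p 0 1 = invGram X p 1 0 := by
  obtain ⟨-, h1, h2, -⟩ := inv_fin_two_apply (gram X p (center p))
  unfold invGram
  rw [h1, h2, gram_symm]

theorem invGram_apply (X : M → Mink) (p : M) :
    invGram X p 0 0 = gram X p (center p) 1 1 / (gram X p (center p)).det ∧
    invGram X p 0 1 = -gram X p (center p) 0 1 / (gram X p (center p)).det ∧
    invGram X p 1 0 = -gram X p (center p) 0 1 / (gram X p (center p)).det ∧
    invGram X p 1 1 = gram X p (center p) 0 0 / (gram X p (center p)).det := by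
  obtain ⟨h0, h1, h2, h3⟩ := inv_fin_two_apply (gram X p (center p))
  rw [gram_symm X p (center p) 1 0] at h2
  exact ⟨h0, h1, h2, h3⟩

theorem differential_gradient (X : M → Mink) {V : Type*} [NormedAddCommGroup V] [NormedSpace ℝ V]
    (f : M → ℝ) (h : M → V) (p : M) :
    differential h p (gradient X f p)
      = ∑ i, ∑ j, (invGram X p i j * differential f p (coordVec j)) •
          differential h p (coordVec i) := by
  have key : ∀ (L : E2 →L[ℝ] V) (c : Fin 2 → Fin 2 → ℝ),
      L (∑ i, ∑ j, c i j • coordVec i) = ∑ i, ∑ j, c i j • L (coordVec i) := by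
    intro L c
    simp only [map_sum, map_smul]
  exact key (differential h p) fun i j => invGram X p i j * differential f p (coordVec j)

theorem differential_gradient_eq_gradDot (X : M → Mink) (f h : M → ℝ) (p : M) :
    differential h p (gradient X f p) = gradDot X f h p := by
  rw [differential_gradient, gradDot]
  simp only [Fin.sum_univ_two, smul_eq_mul, invGram_symm]
  ring

theorem invGram_mul_gram {X : M → Mink} (hX : ContMDiff 𝓘(ℝ, E2) 𝓘(ℝ, Mink) ∞ X)
    (hs : IsSpacelike X) (p : M) (i j : Fin 2) :
    ∑ k, invGram X p i k * gram X p (center p) k j = if i = j then 1 else 0 := by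
  have h := Matrix.nonsing_inv_mul (gram X p (center p))
    (isUnit_iff_ne_zero.mpr (gram_center_pos hX hs p).2.ne')
  have := congrFun (congrFun h i) j
  rw [Matrix.mul_apply, Matrix.one_apply] at this
  exact this

/-- Contracting with g undoes the raising of the index by g⁻¹. -/
theorem lor_gradient_left {X : M → Mink} (hX : ContMDiff 𝓘(ℝ, E2) 𝓘(ℝ, Mink) ∞ X)
    (hs : IsSpacelike X) (f : M → ℝ) (p : M) (v : E2) :
    lor (differential X p (gradient X f p)) (differential X p v) = differential f p v := by
  have hd := (hX p).mdifferentiableAt (by simp)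
  have key : ∀ j, lor (differential X p (gradient X f p)) (differential X p (coordVec j))
      = differential f p (coordVec j) := by
    intro j
    rw [differential_gradient]
    have h0 := invGram_mul_gram hX hs p 0 j
    have h1 := invGram_mul_gram hX hs p 1 j
    simp only [Fin.sum_univ_two, gram_center hd] at h0 h1
    simp only [Fin.sum_univ_two, lor_add_left, lor_smul_left]
    rw [invGram_symm] at h0 ⊢
    fin_cases j
    · norm_num at h0 h1 ⊢
      linear_combination differential f p (coordVec 0) * h0 + differential f p (coordVec 1) * h1
    · norm_num at h0 h1 ⊢
      linear_combination differential f p (coordVec 0) * h0 + differential f p (coordVec 1) * h1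
  rw [differential_eq_sum X p v, differential_eq_sum f p v, lor_add_right, lor_smul_right,
    lor_smul_right, key, key]
  rfl

theorem dot_gradient {X : M → Mink} (hX : ContMDiff 𝓘(ℝ, E2) 𝓘(ℝ, Mink) ∞ X)
    (hs : IsSpacelike X) (f h : M → ℝ) (p : M) :
    dot X p (gradient X f p) (gradient X h p) = differential f p (gradient X h p) :=
  lor_gradient_left hX hs f p (gradient X h p)

/-- Geometric quantities at a point are defined through the preferred chart of that point, which
need not vary continuously. Smoothness is therefore read off from a formula in a single chart. -/
theorem contMDiffAt_of_eq_chart {V : Type*} [NormedAddCommGroup V] [NormedSpace ℝ V] {f : M → V}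
    {p : M} {Φ : E2 → V} (hΦ : ContDiffAt ℝ ∞ Φ (center p))
    (h : ∀ u ∈ (extChartAt 𝓘(ℝ, E2) p).target, f ((extChartAt 𝓘(ℝ, E2) p).symm u) = Φ u) :
    ContMDiffAt 𝓘(ℝ, E2) 𝓘(ℝ, V) ∞ f p := by
  have hcomp : ContMDiffAt 𝓘(ℝ, E2) 𝓘(ℝ, V) ∞ (Φ ∘ extChartAt 𝓘(ℝ, E2) p) p :=
    ContMDiffAt.comp (I' := 𝓘(ℝ, E2)) p hΦ.contMDiffAt contMDiffAt_extChartAt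
  refine hcomp.congr_of_eventuallyEq ?_
  filter_upwards [extChartAt_source_mem_nhds (I := 𝓘(ℝ, E2)) p] with q hq
  have := h _ ((extChartAt 𝓘(ℝ, E2) p).map_source hq)
  rwa [(extChartAt 𝓘(ℝ, E2) p).left_inv hq] at this

variable [IsManifold 𝓘(ℝ, E2) ∞ M]

theorem pd_localRep_eq_sum {V : Type*} [NormedAddCommGroup V] [NormedSpace ℝ V] {f : M → V}
    (hf : ContMDiff 𝓘(ℝ, E2) 𝓘(ℝ, V) ∞ f) {p : M} {u : E2}
    (hu : u ∈ (extChartAt 𝓘(ℝ, E2) p).target) (i : Fin 2) :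
    pd (localRep f p) i u
      = coordMatrix (chartFrame p u) 0 i •
          differential f ((extChartAt 𝓘(ℝ, E2) p).symm u) (coordVec 0)
        + coordMatrix (chartFrame p u) 1 i •
          differential f ((extChartAt 𝓘(ℝ, E2) p).symm u) (coordVec 1) := by
  unfold pd
  rw [fderiv_localRep hf hu]
  exact differential_eq_sum f _ _

/-- The tensor law of the metric between a fixed chart and the preferred chart of the point with
coordinates u. Through `sum_inv_mul_basis_change` it makes metric traces computable in the fixed
chart. -/
theorem gram_eq_basis_change {X : M → Mink}
    (hX : ContMDiff 𝓘(ℝ, E2) 𝓘(ℝ, Mink) ∞ X) {p : M} {u : E2}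
    (hu : u ∈ (extChartAt 𝓘(ℝ, E2) p).target) :
    gram X p u = (coordMatrix (chartFrame p u)).transpose
      * gram X ((extChartAt 𝓘(ℝ, E2) p).symm u) (center ((extChartAt 𝓘(ℝ, E2) p).symm u))
      * coordMatrix (chartFrame p u) := by
  ext i j
  simp only [Matrix.mul_apply, Fin.sum_univ_two, Matrix.transpose_apply,
    gram_center ((hX _).mdifferentiableAt (by simp))]
  simp only [gram, Matrix.of_apply, pd_localRep_eq_sum hX hu, lor_add_left, lor_add_right,
    lor_smul_left, lor_smul_right]
  ring

theorem det_gram_pos {X : M → Mink} (hX : ContMDiff 𝓘(ℝ, E2) 𝓘(ℝ, Mink) ∞ X) (hs : IsSpacelike X)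
    {p : M} {u : E2} (hu : u ∈ (extChartAt 𝓘(ℝ, E2) p).target) : 0 < (gram X p u).det := by
  rw [gram_eq_basis_change hX hu, Matrix.det_mul, Matrix.det_mul, Matrix.det_transpose]
  have h1 := (gram_center_pos hX hs ((extChartAt 𝓘(ℝ, E2) p).symm u)).2
  have h2 := det_coordMatrix_ne_zero (chartFrame p u) (chartFrame_injective hu)
  rw [mul_right_comm]
  exact mul_pos (mul_self_pos.mpr h2) h1

theorem gradDot_eq_chart {X : M → Mink} (hX : ContMDiff 𝓘(ℝ, E2) 𝓘(ℝ, Mink) ∞ X) {f h : M → ℝ}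
    (hf : ContMDiff 𝓘(ℝ, E2) 𝓘(ℝ, ℝ) ∞ f) (hh : ContMDiff 𝓘(ℝ, E2) 𝓘(ℝ, ℝ) ∞ h)
    {p : M} {u : E2} (hu : u ∈ (extChartAt 𝓘(ℝ, E2) p).target) :
    gradDot X f h ((extChartAt 𝓘(ℝ, E2) p).symm u)
      = ∑ i, ∑ j, (gram X p u)⁻¹ i j * (pd (localRep f p) i u * pd (localRep h p) j u) := by
  have key := sum_inv_mul_basis_change
    (gram X ((extChartAt 𝓘(ℝ, E2) p).symm u) (center ((extChartAt 𝓘(ℝ, E2) p).symm u)))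
    (Matrix.of fun i j => differential f ((extChartAt 𝓘(ℝ, E2) p).symm u) (coordVec i)
      * differential h ((extChartAt 𝓘(ℝ, E2) p).symm u) (coordVec j))
    (coordMatrix (chartFrame p u))
    (det_coordMatrix_ne_zero (chartFrame p u) (chartFrame_injective hu))
  rw [← gram_eq_basis_change hX hu] at key
  refine Eq.trans ?_ (key.symm.trans ?_)
  · rfl
  · refine Finset.sum_congr rfl fun i _ => Finset.sum_congr rfl fun j _ => ?_
    congr 1
    rw [pd_localRep_eq_sum hf hu, pd_localRep_eq_sum hh hu]
    simp only [Matrix.mul_apply, Fin.sum_univ_two, Matrix.transpose_apply, Matrix.of_apply,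
      smul_eq_mul]
    ring

theorem contDiffAt_sum_inv_mul {G B : E2 → Matrix (Fin 2) (Fin 2) ℝ} {u : E2}
    (hG : ∀ i j, ContDiffAt ℝ ∞ (fun u => G u i j) u)
    (hB : ∀ i j, ContDiffAt ℝ ∞ (fun u => B u i j) u) (hd : (G u).det ≠ 0) :
    ContDiffAt ℝ ∞ (fun u => ∑ i, ∑ j, (G u)⁻¹ i j * B u i j) u := by
  simp only [sum_inv_mul, Matrix.det_fin_two] at hd ⊢
  exact (((((hG 1 1).mul (hB 0 0)).sub ((hG 0 1).mul (hB 0 1))).sub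
    ((hG 1 0).mul (hB 1 0))).add ((hG 0 0).mul (hB 1 1))).div
    (((hG 0 0).mul (hG 1 1)).sub ((hG 0 1).mul (hG 1 0))) hd

theorem contDiffAt_gram {X : M → Mink} (hX : ContMDiff 𝓘(ℝ, E2) 𝓘(ℝ, Mink) ∞ X) {p : M} {u : E2}
    (hu : u ∈ (extChartAt 𝓘(ℝ, E2) p).target) (i j : Fin 2) :
    ContDiffAt ℝ ∞ (fun u => gram X p u i j) u := by
  have h := contDiffAt_localRep hX hu
  simp only [gram, Matrix.of_apply, ← lorL_apply]
  exact (lorL.contDiff.contDiffAt.comp u (contDiffAt_pd h i)).clm_apply (contDiffAt_pd h j)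

theorem contMDiff_gradDot {X : M → Mink} (hX : ContMDiff 𝓘(ℝ, E2) 𝓘(ℝ, Mink) ∞ X)
    (hs : IsSpacelike X) {f h : M → ℝ}
    (hf : ContMDiff 𝓘(ℝ, E2) 𝓘(ℝ, ℝ) ∞ f) (hh : ContMDiff 𝓘(ℝ, E2) 𝓘(ℝ, ℝ) ∞ h) :
    ContMDiff 𝓘(ℝ, E2) 𝓘(ℝ, ℝ) ∞ (gradDot X f h) := by
  intro p
  have hc := center_mem_target p
  refine contMDiffAt_of_eq_chart (contDiffAt_sum_inv_mul (G := gram X p)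
    (B := fun u => Matrix.of fun i j => pd (localRep f p) i u * pd (localRep h p) j u)
    (contDiffAt_gram hX hc) (fun i j => ?_) (det_gram_pos hX hs hc).ne') fun u hu => ?_
  · exact (contDiffAt_pd (contDiffAt_localRep hf hc) i).mul
      (contDiffAt_pd (contDiffAt_localRep hh hc) j)
  · exact gradDot_eq_chart hX hf hh hu

end Metric

/-! ### Densities and suprema of measures -/

section Density

variable {α β : Type*} [MeasurableSpace α] [MeasurableSpace β]

theorem withDensity_le_withDensity {μ μ' : Measure α} (h : μ ≤ μ') (f : α → ENNReal) :
    μ.withDensity f ≤ μ'.withDensity f := by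
  rw [Measure.le_iff]
  intro s hs
  rw [withDensity_apply _ hs, withDensity_apply _ hs]
  exact lintegral_mono' (Measure.restrict_mono le_rfl h) le_rfl

/-- A density with values in (0, ∞) acts monotonically on measures, with monotone inverse given by
the reciprocal density. It is thus an order isomorphism and commutes with suprema. This suits
`area`, which is a supremum over charts. -/
theorem iSup_withDensity {ι : Type*} (μ : ι → Measure α) {f : α → ENNReal} (hf : Measurable f)
    (h0 : ∀ x, f x ≠ 0) (ht : ∀ x, f x ≠ ⊤) :
    (⨆ i, μ i).withDensity f = ⨆ i, (μ i).withDensity f := by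
  refine le_antisymm ?_ (iSup_le fun i => withDensity_le_withDensity (le_iSup μ i) f)
  set S := ⨆ i, (μ i).withDensity f with hS
  have h1 : ⨆ i, μ i ≤ S.withDensity fun x => (f x)⁻¹ := by
    refine iSup_le fun i => ?_
    have hi := withDensity_le_withDensity (le_iSup (fun i => (μ i).withDensity f) i)
      fun x => (f x)⁻¹
    rwa [withDensity_inv_same hf (.of_forall h0) (.of_forall ht)] at hi
  have h2 := withDensity_le_withDensity h1 f
  have h3 := withDensity_inv_same (μ := S) (f := fun x => (f x)⁻¹) hf.inv
    (.of_forall fun x => ENNReal.inv_ne_zero.mpr (ht x))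
    (.of_forall fun x => ENNReal.inv_ne_top.mpr (h0 x))
  simp only [inv_inv] at h3
  rwa [h3] at h2

/-- Only almost everywhere measurability is asked of φ, since the inverse of a chart is controlled
only on the chart target. -/
theorem map_withDensity_mul_comp {μ : Measure α} {φ : α → β} (hφ : AEMeasurable φ μ)
    {w : α → ENNReal} (hw : AEMeasurable w μ) {f : β → ENNReal} (hf : Measurable f) :
    Measure.map φ (μ.withDensity fun u => w u * f (φ u))
      = (Measure.map φ (μ.withDensity w)).withDensity f := by
  have hw' : AEMeasurable φ (μ.withDensity w) := hφ.mono_ac (withDensity_absolutelyContinuous _ _)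
  ext s hs
  have e : (μ.withDensity fun u => w u * f (φ u))
      = (μ.withDensity w).withDensity (fun u => f (φ u)) :=
    withDensity_mul₀ hw (hf.comp_aemeasurable hφ)
  have hw'' : AEMeasurable φ ((μ.withDensity w).withDensity (fun u => f (φ u))) :=
    hw'.mono_ac (withDensity_absolutelyContinuous _ _)
  rw [e, Measure.map_apply_of_aemeasurable hw'' hs, withDensity_apply _ hs,
    withDensity_apply₀ _ (hw'.nullMeasurableSet_preimage hs),
    Measure.restrict_map_of_aemeasurable hw' hs,
    lintegral_map' hf.aemeasurable (hw'.mono_ac Measure.absolutelyContinuous_restrict)]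

end Density

/-! ### The projected surface -/

section Projection

variable {M : Type*} [TopologicalSpace M] [ChartedSpace E2 M]

theorem contMDiff_const_mink (c : Mink) : ContMDiff 𝓘(ℝ, E2) 𝓘(ℝ, Mink) ∞ (fun _ : M => c) :=
  contMDiff_const

theorem contMDiff_timeFun (T₀ : Mink) {X : M → Mink} (hX : ContMDiff 𝓘(ℝ, E2) 𝓘(ℝ, Mink) ∞ X) :
    ContMDiff 𝓘(ℝ, E2) 𝓘(ℝ, ℝ) ∞ (timeFun T₀ X) :=
  (contMDiff_lor hX (contMDiff_const_mink T₀)).neg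

theorem contMDiff_proj (T₀ : Mink) {X : M → Mink} (hX : ContMDiff 𝓘(ℝ, E2) 𝓘(ℝ, Mink) ∞ X) :
    ContMDiff 𝓘(ℝ, E2) 𝓘(ℝ, Mink) ∞ (proj T₀ X) :=
  hX.sub ((contMDiff_timeFun T₀ hX).smul (contMDiff_const_mink T₀))

theorem differential_timeFun (T₀ : Mink) {X : M → Mink} {p : M}
    (hX : MDifferentiableAt 𝓘(ℝ, E2) 𝓘(ℝ, Mink) X p) (v : TangentSpace 𝓘(ℝ, E2) p) :
    differential (timeFun T₀ X) p v = -lor (differential X p v) T₀ := by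
  have e : timeFun T₀ X = fun q => lor (X q) (-T₀) := by
    funext q; rw [lor_neg_right]; rfl
  rw [e, differential_lor hX mdifferentiableAt_const, differential_const, lor_zero_right, add_zero,
    lor_neg_right]

theorem differential_proj (T₀ : Mink) {X : M → Mink} {p : M}
    (hX : MDifferentiableAt 𝓘(ℝ, E2) 𝓘(ℝ, Mink) X p) (v : TangentSpace 𝓘(ℝ, E2) p) :
    differential (proj T₀ X) p v = differential X p v - differential (timeFun T₀ X) p v • T₀ := by
  -- The projection is linear in the position vector: y ↦ y + ⟨y, T₀⟩ T₀.
  let L : Mink →L[ℝ] Mink := ContinuousLinearMap.id ℝ Mink + (lorL.flip T₀).smulRight T₀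
  have hL : ∀ y, L y = y - (-lor y T₀) • T₀ := by
    intro y
    simp [L, lorL_apply]
  have e : proj T₀ X = L ∘ X := by
    funext q
    rw [Function.comp_apply, hL]
    rfl
  have hc : MDifferentiableAt 𝓘(ℝ, E2) 𝓘(ℝ, Mink) (L ∘ X) p :=
    L.differentiableAt.comp_mdifferentiableAt hX
  have e' : localRep (L ∘ X) p = L ∘ localRep X p := rfl
  rw [differential_timeFun T₀ hX, ← hL, e, differential_eq_fderiv hc, e',
    (L.hasFDerivAt.comp _ (differentiableAt_localRep_center hX).hasFDerivAt).fderiv,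
    differential_eq_fderiv hX]
  rfl

theorem lapse_eq {X : M → Mink} (hX : ContMDiff 𝓘(ℝ, E2) 𝓘(ℝ, Mink) ∞ X) (hs : IsSpacelike X)
    (T₀ : Mink) (p : M) :
    lapse T₀ X p = 1 + gradDot X (timeFun T₀ X) (timeFun T₀ X) p := by
  rw [lapse, dot_gradient hX hs, differential_gradient_eq_gradDot]

theorem one_le_lapse {X : M → Mink} (hs : IsSpacelike X) (T₀ : Mink) (p : M) :
    1 ≤ lapse T₀ X p := by
  unfold lapse
  by_cases h : gradient X (timeFun T₀ X) p = 0
  · rw [h, dot]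
    have : differential X p (0 : TangentSpace 𝓘(ℝ, E2) p) = 0 := map_zero (differential X p)
    rw [this, lor_zero_left, add_zero]
  · have : 0 < dot X p (gradient X (timeFun T₀ X) p) (gradient X (timeFun T₀ X) p) := hs p _ h
    linarith

theorem lapse_pos {X : M → Mink} (hs : IsSpacelike X) (T₀ : Mink) (p : M) : 0 < lapse T₀ X p :=
  one_pos.trans_le (one_le_lapse hs T₀ p)

theorem lor_sub_smul_sub_smul {T₀ : Mink} (hT₀ : lor T₀ T₀ = -1) {a b : Mink} {s t : ℝ}
    (hs : s = -lor a T₀) (ht : t = -lor b T₀) :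
    lor (a - s • T₀) (b - t • T₀) = lor a b + s * t := by
  simp only [lor_sub_left, lor_sub_right, lor_smul_left, lor_smul_right, hT₀, lor_comm T₀ b]
  rw [hs, ht]
  ring

/-- Discarding the T₀-components removes their negative contribution to the inner product, so ĝ = g
+ dτ ⊗ dτ. -/
theorem lor_differential_proj {T₀ : Mink} (hT₀ : lor T₀ T₀ = -1) {X : M → Mink} {p : M}
    (hX : MDifferentiableAt 𝓘(ℝ, E2) 𝓘(ℝ, Mink) X p) (v w : TangentSpace 𝓘(ℝ, E2) p) :
    lor (differential (proj T₀ X) p v) (differential (proj T₀ X) p w)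
      = lor (differential X p v) (differential X p w)
        + differential (timeFun T₀ X) p v * differential (timeFun T₀ X) p w := by
  rw [differential_proj T₀ hX, differential_proj T₀ hX]
  exact lor_sub_smul_sub_smul hT₀ (differential_timeFun T₀ hX v) (differential_timeFun T₀ hX w)

theorem isSpacelike_proj {T₀ : Mink} (hT₀ : lor T₀ T₀ = -1) {X : M → Mink}
    (hX : ContMDiff 𝓘(ℝ, E2) 𝓘(ℝ, Mink) ∞ X) (hs : IsSpacelike X) : IsSpacelike (proj T₀ X) := by
  intro p v hv
  rw [lor_differential_proj hT₀ ((hX p).mdifferentiableAt (by simp))]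
  have h1 := hs p v hv
  have h2 := mul_self_nonneg (differential (timeFun T₀ X) p v : ℝ)
  linarith

theorem contMDiff_lapse (T₀ : Mink) {X : M → Mink} [IsManifold 𝓘(ℝ, E2) ∞ M]
    (hX : ContMDiff 𝓘(ℝ, E2) 𝓘(ℝ, Mink) ∞ X) (hs : IsSpacelike X) :
    ContMDiff 𝓘(ℝ, E2) 𝓘(ℝ, ℝ) ∞ (lapse T₀ X) := by
  have e : lapse T₀ X = fun p => 1 + gradDot X (timeFun T₀ X) (timeFun T₀ X) p :=
    funext fun p => lapse_eq hX hs T₀ p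
  rw [e]
  exact contMDiff_const.add
    (contMDiff_gradDot hX hs (contMDiff_timeFun T₀ hX) (contMDiff_timeFun T₀ hX))

theorem gram_proj {T₀ : Mink} (hT₀ : lor T₀ T₀ = -1) {X : M → Mink} [IsManifold 𝓘(ℝ, E2) ∞ M]
    (hX : ContMDiff 𝓘(ℝ, E2) 𝓘(ℝ, Mink) ∞ X) {p : M} {u : E2}
    (hu : u ∈ (extChartAt 𝓘(ℝ, E2) p).target) (i j : Fin 2) :
    gram (proj T₀ X) p u i j = gram X p u i j
      + pd (localRep (timeFun T₀ X) p) i u * pd (localRep (timeFun T₀ X) p) j u := by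
  simp only [gram, Matrix.of_apply, pd, fderiv_localRep (contMDiff_proj T₀ hX) hu,
    fderiv_localRep hX hu, fderiv_localRep (contMDiff_timeFun T₀ hX) hu]
  exact lor_differential_proj hT₀ ((hX _).mdifferentiableAt (by simp)) _ _

/-- The determinant of a rank-one perturbation: det(g + t tᵀ) = det g · (1 + g⁻¹(t, t)) with t = dτ.
-/
theorem det_gram_proj {T₀ : Mink} (hT₀ : lor T₀ T₀ = -1) {X : M → Mink}
    [IsManifold 𝓘(ℝ, E2) ∞ M] (hX : ContMDiff 𝓘(ℝ, E2) 𝓘(ℝ, Mink) ∞ X) (hs : IsSpacelike X)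
    {p : M} {u : E2} (hu : u ∈ (extChartAt 𝓘(ℝ, E2) p).target) :
    (gram (proj T₀ X) p u).det
      = (gram X p u).det * lapse T₀ X ((extChartAt 𝓘(ℝ, E2) p).symm u) := by
  have hτ := contMDiff_timeFun T₀ hX
  have hD := (det_gram_pos hX hs hu).ne'
  rw [lapse_eq hX hs, gradDot_eq_chart hX hτ hτ hu]
  have := sum_inv_mul (gram X p u) (Matrix.of fun i j =>
    pd (localRep (timeFun T₀ X) p) i u * pd (localRep (timeFun T₀ X) p) j u)
  simp only [Matrix.of_apply] at this
  rw [this, mul_add, mul_one, mul_div_cancel₀ _ hD, det_gram, det_gram]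
  simp only [gram_proj hT₀ hX hu, gram_symm X p u 1 0]
  ring

theorem area_proj {T₀ : Mink} (hT₀ : lor T₀ T₀ = -1) {X : M → Mink}
    [IsManifold 𝓘(ℝ, E2) ∞ M] [MeasurableSpace M] [BorelSpace M]
    (hX : ContMDiff 𝓘(ℝ, E2) 𝓘(ℝ, Mink) ∞ X) (hs : IsSpacelike X) :
    area (proj T₀ X)
      = (area X).withDensity fun p => ENNReal.ofReal (Real.sqrt (lapse T₀ X p)) := by
  have hm : Measurable fun p => ENNReal.ofReal (Real.sqrt (lapse T₀ X p)) :=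
    (Real.continuous_sqrt.comp (contMDiff_lapse T₀ hX hs).continuous).measurable.ennreal_ofReal
  unfold area
  rw [iSup_withDensity _ hm
    (fun p => (ENNReal.ofReal_pos.mpr (Real.sqrt_pos.mpr (lapse_pos hs T₀ p))).ne')
    fun p => ENNReal.ofReal_ne_top]
  congr 1
  funext p
  have ht := (isOpen_extChartAt_target (I := 𝓘(ℝ, E2)) p).measurableSet
  rw [← map_withDensity_mul_comp ((continuousOn_extChartAt_symm p).aemeasurable ht) _ hm]
  · congr 1
    refine withDensity_congr_ae ?_
    filter_upwards [ae_restrict_mem ht] with u hu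
    rw [det_gram_proj hT₀ hX hs hu, Real.sqrt_mul (det_gram_pos hX hs hu).le,
      ENNReal.ofReal_mul (Real.sqrt_nonneg _)]
  · refine AEMeasurable.ennreal_ofReal (ContinuousOn.aemeasurable (fun u hu => ?_) ht)
    have hG := fun i j => (contDiffAt_gram hX hu i j).continuousAt
    simp only [Matrix.det_fin_two]
    exact (((hG 0 0).mul (hG 1 1)).sub ((hG 0 1).mul (hG 1 0))).sqrt.continuousWithinAt

theorem integral_area_proj {T₀ : Mink} (hT₀ : lor T₀ T₀ = -1) {X : M → Mink}
    [IsManifold 𝓘(ℝ, E2) ∞ M] [MeasurableSpace M] [BorelSpace M]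
    (hX : ContMDiff 𝓘(ℝ, E2) 𝓘(ℝ, Mink) ∞ X) (hs : IsSpacelike X) (f : M → ℝ) :
    ∫ p, f p ∂(area (proj T₀ X)) = ∫ p, f p * Real.sqrt (lapse T₀ X p) ∂(area X) := by
  have hm : Measurable fun p => ENNReal.ofReal (Real.sqrt (lapse T₀ X p)) :=
    (Real.continuous_sqrt.comp (contMDiff_lapse T₀ hX hs).continuous).measurable.ennreal_ofReal
  rw [area_proj hT₀ hX hs,
    integral_withDensity_eq_integral_toReal_smul hm (.of_forall fun _ => ENNReal.ofReal_lt_top)]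
  refine integral_congr_ae (.of_forall fun p => ?_)
  simp only [ENNReal.toReal_ofReal (Real.sqrt_nonneg _), smul_eq_mul]
  ring

end Projection

section Normal

variable {M : Type*} [TopologicalSpace M] [ChartedSpace E2 M]

/-! ### The normal bundle -/

/-- The component of `T₀` normal to the surface, `T₀ + ∇ τ`. -/
noncomputable def normalTime (T₀ : Mink) (X : M → Mink) (p : M) : Mink :=
  T₀ + differential X p (gradient X (timeFun T₀ X) p)

/-- The future-directed unit normal in the direction of the normal component of `T₀`. -/
noncomputable def unitNormalTime (T₀ : Mink) (X : M → Mink) (p : M) : Mink :=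
  (Real.sqrt (lapse T₀ X p))⁻¹ • normalTime T₀ X p

theorem lor_normalTime_differential {X : M → Mink} (hX : ContMDiff 𝓘(ℝ, E2) 𝓘(ℝ, Mink) ∞ X)
    (hs : IsSpacelike X) (T₀ : Mink) (p : M) (v : TangentSpace 𝓘(ℝ, E2) p) :
    lor (normalTime T₀ X p) (differential X p v) = 0 := by
  have h : lor (differential X p (gradient X (timeFun T₀ X) p)) (differential X p v)
      = differential (timeFun T₀ X) p v := lor_gradient_left hX hs _ p v
  rw [normalTime, lor_add_left, h, differential_timeFun T₀ ((hX p).mdifferentiableAt (by simp)),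
    lor_comm]
  exact add_neg_cancel _

theorem lor_normalTime_self {T₀ : Mink} (hT₀ : lor T₀ T₀ = -1) {X : M → Mink}
    (hX : ContMDiff 𝓘(ℝ, E2) 𝓘(ℝ, Mink) ∞ X) (hs : IsSpacelike X) (p : M) :
    lor (normalTime T₀ X p) T₀ = -lapse T₀ X p := by
  have h := differential_timeFun T₀ ((hX p).mdifferentiableAt (by simp))
    (gradient X (timeFun T₀ X) p)
  rw [normalTime, lor_add_left, hT₀, lapse, dot_gradient hX hs, h]
  ring

/-- The vector is normal, so its product with itself equals its product with T₀, from which it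
differs by a tangent vector. -/
theorem lor_normalTime_normalTime {T₀ : Mink} (hT₀ : lor T₀ T₀ = -1) {X : M → Mink}
    (hX : ContMDiff 𝓘(ℝ, E2) 𝓘(ℝ, Mink) ∞ X) (hs : IsSpacelike X) (p : M) :
    lor (normalTime T₀ X p) (normalTime T₀ X p) = -lapse T₀ X p := by
  rw [← lor_normalTime_self hT₀ hX hs]
  conv_lhs => rw [normalTime, lor_add_left]
  rw [← normalTime, lor_comm (differential X p _), lor_normalTime_differential hX hs, add_zero,
    lor_comm]

theorem IsUnitNormalOfProj.lor_differential {T₀ : Mink} {X ν : M → Mink}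
    (hν : IsUnitNormalOfProj T₀ X ν) (hX : ContMDiff 𝓘(ℝ, E2) 𝓘(ℝ, Mink) ∞ X) (p : M)
    (v : TangentSpace 𝓘(ℝ, E2) p) : lor (ν p) (differential X p v) = 0 := by
  have h := hν.normal p v
  have h0 : lor (ν p) T₀ = 0 := hν.mem_slice p
  rw [differential_proj T₀ ((hX p).mdifferentiableAt (by simp)), lor_sub_right, lor_smul_right, h0,
    mul_zero, sub_zero] at h
  exact h

theorem IsUnitNormalOfProj.lor_normalTime {T₀ : Mink} {X ν : M → Mink}
    (hν : IsUnitNormalOfProj T₀ X ν) (hX : ContMDiff 𝓘(ℝ, E2) 𝓘(ℝ, Mink) ∞ X) (p : M) :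
    lor (normalTime T₀ X p) (ν p) = 0 := by
  have h0 : lor (ν p) T₀ = 0 := hν.mem_slice p
  rw [lor_comm, normalTime, lor_add_right, h0, hν.lor_differential hX, add_zero]

theorem isFutureUnitNormal_unitNormalTime {T₀ : Mink} (hT₀ : lor T₀ T₀ = -1) {X ν : M → Mink}
    (hX : ContMDiff 𝓘(ℝ, E2) 𝓘(ℝ, Mink) ∞ X) (hs : IsSpacelike X)
    (hν : IsUnitNormalOfProj T₀ X ν) (p : M) :
    IsFutureUnitNormal T₀ X p (ν p) (unitNormalTime T₀ X p) := by
  have hL := Real.sqrt_pos.mpr (lapse_pos hs T₀ p)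
  have hL2 := Real.mul_self_sqrt (lapse_pos hs T₀ p).le
  refine ⟨?_, fun v => ?_, ?_, ?_⟩
  · rw [unitNormalTime, lor_smul_left, lor_smul_right, lor_normalTime_normalTime hT₀ hX hs]
    nth_rw 3 [← hL2]
    field_simp
  · rw [unitNormalTime, lor_smul_left, lor_normalTime_differential hX hs, mul_zero]
  · rw [unitNormalTime, lor_smul_left, hν.lor_normalTime hX, mul_zero]
  · rw [unitNormalTime, lor_smul_left, lor_normalTime_self hT₀ hX hs, mul_neg]
    exact neg_neg_of_pos (mul_pos (inv_pos.mpr hL) (lapse_pos hs T₀ p))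

/-- A vector orthogonal to the surface and to an orthonormal frame of its normal space vanishes. -/
theorem eq_zero_of_orthogonal_adapted_frame {X : M → Mink}
    (hX : ContMDiff 𝓘(ℝ, E2) 𝓘(ℝ, Mink) ∞ X) (hs : IsSpacelike X) {p : M} {e w z : Mink}
    (he : ∀ v, lor e (differential X p v) = 0) (hw : ∀ v, lor w (differential X p v) = 0)
    (hee : lor e e = 1) (hww : lor w w = -1) (hwe : lor w e = 0)
    (hz : ∀ v, lor z (differential X p v) = 0) (hze : lor z e = 0) (hzw : lor z w = 0) :
    z = 0 := by
  have hD := (gram_center_pos hX hs p).2.ne'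
  have hd := (hX p).mdifferentiableAt (by simp)
  rw [det_gram, gram_center hd, gram_center hd, gram_center hd] at hD
  refine eq_zero_of_orthogonal_frame (a := differential X p (coordVec 0))
    (b := differential X p (coordVec 1)) (e := e) (w := w) hD (he _) (he _) (hw _) (hw _) hwe hee hww
    ?_ ?_ ?_ ?_
  · rw [lor_comm]; exact hz _
  · rw [lor_comm]; exact hz _
  · rw [lor_comm]; exact hze
  · rw [lor_comm]; exact hzw

/-- `futureNormal` is an arbitrary choice, so uniqueness is what identifies it: in the normal plane
the unit time-like vectors orthogonal to e are ±w, and the time orientation excludes −w. -/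
theorem futureNormal_eq {T₀ : Mink} {X : M → Mink} (hX : ContMDiff 𝓘(ℝ, E2) 𝓘(ℝ, Mink) ∞ X)
    (hs : IsSpacelike X) {e : M → Mink} {p : M} {w : Mink}
    (he : ∀ v, lor (e p) (differential X p v) = 0) (hee : lor (e p) (e p) = 1)
    (hw : IsFutureUnitNormal T₀ X p (e p) w) : futureNormal T₀ X e p = w := by
  have hspec : IsFutureUnitNormal T₀ X p (e p) (futureNormal T₀ X e p) :=
    Classical.epsilon_spec ⟨w, hw⟩
  generalize futureNormal T₀ X e p = w' at hspec
  obtain ⟨h1, h2, h3, h4⟩ := hw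
  obtain ⟨k1, k2, k3, k4⟩ := hspec
  have hz : w' + lor w' w • w = 0 := by
    refine eq_zero_of_orthogonal_adapted_frame hX hs he h2 hee h1 h3 (fun v => ?_) ?_ ?_
    · rw [lor_add_left, lor_smul_left, h2, k2, mul_zero, add_zero]
    · rw [lor_add_left, lor_smul_left, h3, k3, mul_zero, add_zero]
    · rw [lor_add_left, lor_smul_left, h1]; ring
  have e1 : w' = -lor w' w • w := by
    rw [neg_smul]; exact eq_neg_of_add_eq_zero_left hz
  set c := -lor w' w with hc
  have hc2 : c * c = 1 := by
    have : lor w' w' = c * (c * lor w w) := by rw [e1, lor_smul_left, lor_smul_right]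
    rw [k1, h1] at this
    linarith
  have hc0 : 0 < c := by
    rw [e1, lor_smul_left] at k4
    by_contra hneg
    exact absurd k4 (not_lt.mpr (mul_nonneg_of_nonpos_of_nonpos (not_lt.mp hneg) h4.le))
  have : c = 1 := by
    rcases mul_self_eq_one_iff.mp hc2 with h | h
    · exact h
    · linarith
  rw [e1, this, one_smul]

/-! ### The mean curvature vector -/

theorem lor_normalPart_differential {X : M → Mink} (hX : ContMDiff 𝓘(ℝ, E2) 𝓘(ℝ, Mink) ∞ X)
    (hs : IsSpacelike X) (p : M) (y : Mink) (v : TangentSpace 𝓘(ℝ, E2) p) :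
    lor (normalPart X p y) (differential X p v) = 0 := by
  have hd := (hX p).mdifferentiableAt (by simp)
  have key : ∀ k, lor (normalPart X p y) (differential X p (coordVec k)) = 0 := by
    intro k
    have h0 := invGram_mul_gram hX hs p 0 k
    have h1 := invGram_mul_gram hX hs p 1 k
    simp only [Fin.sum_univ_two, gram_center hd] at h0 h1
    simp only [normalPart, Fin.sum_univ_two, lor_add_left, lor_smul_left, lor_sub_left]
    fin_cases k
    · norm_num at h0 h1 ⊢
      linear_combination -lor y (differential X p (coordVec 0)) * h0
        - lor y (differential X p (coordVec 1)) * h1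
    · norm_num at h0 h1 ⊢
      linear_combination -lor y (differential X p (coordVec 0)) * h0
        - lor y (differential X p (coordVec 1)) * h1
  rw [differential_eq_sum X p v, lor_add_right, lor_smul_right, lor_smul_right, key, key]
  ring

theorem lor_normalPart_of_normal {X : M → Mink} {p : M} {n : Mink}
    (hn : ∀ v, lor n (differential X p v) = 0) (y : Mink) :
    lor (normalPart X p y) n = lor y n := by
  have h : ∀ j, lor (differential X p (coordVec j)) n = 0 := fun j => by rw [lor_comm]; exact hn _
  simp only [normalPart, Fin.sum_univ_two, lor_add_left, lor_smul_left, lor_sub_left, h]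
  ring

theorem lor_meanCurvatureVector_differential {X : M → Mink}
    (hX : ContMDiff 𝓘(ℝ, E2) 𝓘(ℝ, Mink) ∞ X) (hs : IsSpacelike X) (p : M)
    (v : TangentSpace 𝓘(ℝ, E2) p) :
    lor (meanCurvatureVector X p) (differential X p v) = 0 := by
  simp only [meanCurvatureVector, secondFundamentalForm, Fin.sum_univ_two, lor_add_left,
    lor_smul_left, lor_normalPart_differential hX hs]
  ring

theorem pd_lor {F G : E2 → Mink} {u : E2} (hF : DifferentiableAt ℝ F u)
    (hG : DifferentiableAt ℝ G u) (i : Fin 2) :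
    pd (fun u => lor (F u) (G u)) i u = lor (pd F i u) (G u) + lor (F u) (pd G i u) := by
  have h := lorL.hasFDerivAt_of_bilinear hF.hasFDerivAt hG.hasFDerivAt
  simp only [lorL_apply] at h
  unfold pd
  rw [h.fderiv]
  simp [lorL_apply, add_comm]

variable [IsManifold 𝓘(ℝ, E2) ∞ M]

theorem contMDiff_normalTime (T₀ : Mink) {X : M → Mink} (hX : ContMDiff 𝓘(ℝ, E2) 𝓘(ℝ, Mink) ∞ X)
    (hs : IsSpacelike X) : ContMDiff 𝓘(ℝ, E2) 𝓘(ℝ, Mink) ∞ (normalTime T₀ X) := by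
  rw [contMDiff_mink]
  intro k
  have e : (fun q => normalTime T₀ X q k)
      = fun q => T₀ k + gradDot X (timeFun T₀ X) (fun q => X q k) q := by
    funext q
    rw [← differential_gradient_eq_gradDot,
      differential_apply ((hX q).mdifferentiableAt (by simp))]
    rfl
  rw [e]
  exact contMDiff_const.add
    (contMDiff_gradDot hX hs (contMDiff_timeFun T₀ hX) (contMDiff_mink.mp hX k))

theorem contMDiff_unitNormalTime (T₀ : Mink) {X : M → Mink}
    (hX : ContMDiff 𝓘(ℝ, E2) 𝓘(ℝ, Mink) ∞ X) (hs : IsSpacelike X) :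
    ContMDiff 𝓘(ℝ, E2) 𝓘(ℝ, Mink) ∞ (unitNormalTime T₀ X) := by
  have h : ContMDiff 𝓘(ℝ, E2) 𝓘(ℝ, ℝ) ∞ (fun p => (Real.sqrt (lapse T₀ X p))⁻¹) := by
    intro p
    have hp := lapse_pos hs T₀ p
    have h1 : ContDiffAt ℝ ∞ (fun t => (Real.sqrt t)⁻¹) (lapse T₀ X p) :=
      (Real.contDiffAt_sqrt hp.ne').inv (Real.sqrt_pos.mpr hp).ne'
    exact h1.comp_contMDiffAt (contMDiff_lapse T₀ hX hs p)
  exact h.smul (contMDiff_normalTime T₀ hX hs)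

theorem lor_pd_eq_zero {X n : M → Mink} (hX : ContMDiff 𝓘(ℝ, E2) 𝓘(ℝ, Mink) ∞ X)
    (hn : ∀ p v, lor (n p) (differential X p v) = 0) {p : M} {u : E2}
    (hu : u ∈ (extChartAt 𝓘(ℝ, E2) p).target) (j : Fin 2) :
    lor (pd (localRep X p) j u) (localRep n p u) = 0 := by
  unfold pd
  rw [fderiv_localRep hX hu, lor_comm]
  exact hn _ _

/-- Weingarten's formula: differentiate ⟨∂_j X, n⟩ = 0, which holds on the whole chart target and
not only at the centre. -/
theorem lor_pd_pd {X n : M → Mink} (hX : ContMDiff 𝓘(ℝ, E2) 𝓘(ℝ, Mink) ∞ X)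
    (hn : ∀ p v, lor (n p) (differential X p v) = 0)
    (hn' : ContMDiff 𝓘(ℝ, E2) 𝓘(ℝ, Mink) ∞ n) (p : M) (i j : Fin 2) :
    lor (pd (pd (localRep X p) j) i (center p)) (n p)
      = -lor (differential n p (coordVec i)) (differential X p (coordVec j)) := by
  have hc := center_mem_target p
  have hz : (fun u => lor (pd (localRep X p) j u) (localRep n p u)) =ᶠ[𝓝 (center p)] fun _
      => 0 := by
    filter_upwards [(isOpen_extChartAt_target (I := 𝓘(ℝ, E2)) p).mem_nhds hc] with u hu
    exact lor_pd_eq_zero hX hn hu j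
  have h0 : pd (fun u => lor (pd (localRep X p) j u) (localRep n p u)) i (center p) = 0 := by
    unfold pd at hz ⊢
    rw [hz.fderiv_eq]
    simp
  rw [pd_lor ((contDiffAt_pd (contDiffAt_localRep hX hc) j).differentiableAt (by simp))
    ((contDiffAt_localRep hn' hc).differentiableAt (by simp)), localRep_center,
    pd_center ((hn' p).mdifferentiableAt (by simp)),
    pd_center ((hX p).mdifferentiableAt (by simp))] at h0
  rw [eq_neg_of_add_eq_zero_left h0, lor_comm]

/-- The component of the mean curvature vector along a normal field is minus the trace of the
corresponding shape operator. -/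
theorem lor_meanCurvatureVector {X n : M → Mink} (hX : ContMDiff 𝓘(ℝ, E2) 𝓘(ℝ, Mink) ∞ X)
    (hn : ∀ p v, lor (n p) (differential X p v) = 0)
    (hn' : ContMDiff 𝓘(ℝ, E2) 𝓘(ℝ, Mink) ∞ n) (p : M) :
    lor (meanCurvatureVector X p) (n p)
      = -∑ i, ∑ j, invGram X p i j
          * lor (differential n p (coordVec i)) (differential X p (coordVec j)) := by
  simp only [meanCurvatureVector, secondFundamentalForm, Fin.sum_univ_two, lor_add_left,
    lor_smul_left, lor_normalPart_of_normal (hn p), lor_pd_pd hX hn hn']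
  ring

/-- The trace of the shape operator is a signed sum of products g⁻¹(dn^k, dX^k) over the Minkowski
components. This needs only first derivatives and avoids the smoothness of the mean curvature vector
itself. -/
theorem contMDiff_lor_meanCurvatureVector {X n : M → Mink}
    (hX : ContMDiff 𝓘(ℝ, E2) 𝓘(ℝ, Mink) ∞ X) (hs : IsSpacelike X)
    (hn : ∀ p v, lor (n p) (differential X p v) = 0)
    (hn' : ContMDiff 𝓘(ℝ, E2) 𝓘(ℝ, Mink) ∞ n) :
    ContMDiff 𝓘(ℝ, E2) 𝓘(ℝ, ℝ) ∞ (fun p => lor (meanCurvatureVector X p) (n p)) := by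
  have hg : ∀ k, ContMDiff 𝓘(ℝ, E2) 𝓘(ℝ, ℝ) ∞ (gradDot X (fun q => n q k) (fun q => X q k)) :=
    fun k => contMDiff_gradDot hX hs (contMDiff_mink.mp hn' k) (contMDiff_mink.mp hX k)
  have e : (fun p => lor (meanCurvatureVector X p) (n p))
      = fun p => gradDot X (fun q => n q 0) (fun q => X q 0) p
        - gradDot X (fun q => n q 1) (fun q => X q 1) p
        - gradDot X (fun q => n q 2) (fun q => X q 2) p
        - gradDot X (fun q => n q 3) (fun q => X q 3) p := by
    funext p
    rw [lor_meanCurvatureVector hX hn hn']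
    have h1 := fun k j => differential_apply ((hX p).mdifferentiableAt (by simp)) k (coordVec j)
    have h2 := fun k j => differential_apply ((hn' p).mdifferentiableAt (by simp)) k (coordVec j)
    simp only [gradDot, h1, h2, lor, Fin.sum_univ_two]
    ring
  rw [e]
  exact (((hg 0).sub (hg 1)).sub (hg 2)).sub (hg 3)

theorem pd_pd_comm {F : E2 → Mink} {u : E2} (hF : ContDiffAt ℝ ∞ F u) (i j : Fin 2) :
    pd (pd F j) i u = pd (pd F i) j u := by
  have hd : DifferentiableAt ℝ (fderiv ℝ F) u :=
    (hF.fderiv_right (m := ∞) (by simp)).differentiableAt (by simp)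
  have key : ∀ i j, pd (pd F j) i u = fderiv ℝ (fderiv ℝ F) u (coordVec i) (coordVec j) := by
    intro i j
    have h := hd.hasFDerivAt.clm_apply (hasFDerivAt_const (coordVec j) u)
    have : pd (pd F j) i u = fderiv ℝ (fun y => fderiv ℝ F y (coordVec j)) u (coordVec i) := rfl
    rw [this, h.fderiv]
    simp
  rw [key, key]
  exact (hF.isSymmSndFDerivAt (by
    rw [minSmoothness_of_isRCLikeNormedField]; exact WithTop.coe_le_coe.mpr le_top)).eq _ _

/-- Expanding the derivatives of g_{ij} = ⟨∂_i X, ∂_j X⟩, all but one pair of terms cancel by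
symmetry of second derivatives. The induced connection is the tangential part of the flat one. -/
theorem christoffel_eq {X : M → Mink} (hX : ContMDiff 𝓘(ℝ, E2) 𝓘(ℝ, Mink) ∞ X) (p : M)
    (k i j : Fin 2) :
    christoffel X p k i j = ∑ l, invGram X p k l
      * lor (pd (pd (localRep X p) j) i (center p)) (differential X p (coordVec l)) := by
  have hF := contDiffAt_localRep hX (center_mem_target p)
  have hd := fun j => (contDiffAt_pd hF j).differentiableAt (by simp)
  have hg : ∀ a b c, pd (fun u => gram X p u a b) c (center p)
      = lor (pd (pd (localRep X p) a) c (center p)) (differential X p (coordVec b))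
        + lor (pd (pd (localRep X p) b) c (center p)) (differential X p (coordVec a)) := by
    intro a b c
    have := pd_lor (hd a) (hd b) c
    rw [pd_center ((hX p).mdifferentiableAt (by simp)),
      pd_center ((hX p).mdifferentiableAt (by simp))] at this
    exact this.trans (congrArg _ (lor_comm _ _))
  rw [christoffel, Finset.mul_sum]
  refine Finset.sum_congr rfl fun l _ => ?_
  rw [hg, hg, hg, pd_pd_comm hF j i, pd_pd_comm hF l i, pd_pd_comm hF l j]
  ring

/-- This is ΔX = H₀ paired with the constant −T₀: subtracting the Christoffel terms from ∂_i ∂_j X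
leaves its normal part. -/
theorem laplacian_timeFun (T₀ : Mink) {X : M → Mink} (hX : ContMDiff 𝓘(ℝ, E2) 𝓘(ℝ, Mink) ∞ X)
    (p : M) : laplacian X (timeFun T₀ X) p = -lor (meanCurvatureVector X p) T₀ := by
  have hc := center_mem_target p
  have hF := contDiffAt_localRep hX hc
  have hXp := (hX p).mdifferentiableAt (by simp)
  have hτp := (contMDiff_timeFun T₀ hX p).mdifferentiableAt (by simp)
  have h2 : ∀ i j, pd (pd (localRep (timeFun T₀ X) p) j) i (center p)
      = -lor (pd (pd (localRep X p) j) i (center p)) T₀ := by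
    intro i j
    have e : pd (localRep (timeFun T₀ X) p) j
        =ᶠ[𝓝 (center p)] fun u => lor (pd (localRep X p) j u) (-T₀) := by
      filter_upwards [(isOpen_extChartAt_target (I := 𝓘(ℝ, E2)) p).mem_nhds hc] with u hu
      unfold pd
      rw [fderiv_localRep (contMDiff_timeFun T₀ hX) hu, fderiv_localRep hX hu, lor_neg_right]
      exact differential_timeFun T₀ ((hX _).mdifferentiableAt (by simp)) _
    have e' := pd_lor ((contDiffAt_pd hF j).differentiableAt (by simp))
      (differentiableAt_const (-T₀) : DifferentiableAt ℝ (fun _ : E2 => -T₀) (center p)) i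
    have e0 : pd (fun _ : E2 => -T₀) i (center p) = 0 := by simp [pd]
    rw [e0, lor_zero_right, add_zero, lor_neg_right] at e'
    rw [← e']
    exact congrArg (fun L : E2 →L[ℝ] ℝ => L (coordVec i)) e.fderiv_eq
  have h1 := fun j => differential_timeFun T₀ hXp (coordVec j)
  simp only [laplacian, h2, christoffel_eq hX, pd_center hτp, h1,
    meanCurvatureVector, secondFundamentalForm, normalPart, Fin.sum_univ_two, lor_add_left,
    lor_smul_left, lor_sub_left, invGram_symm]
  ring

end Normal

section Identities

variable {M : Type*} [TopologicalSpace M] [ChartedSpace E2 M]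

/-! ### The frame determined by the mean curvature vector -/

theorem meanCurvatureVector_eq {X e w : M → Mink} (hX : ContMDiff 𝓘(ℝ, E2) 𝓘(ℝ, Mink) ∞ X)
    (hs : IsSpacelike X) {p : M} (he : ∀ v, lor (e p) (differential X p v) = 0)
    (hw : ∀ v, lor (w p) (differential X p v) = 0) (hee : lor (e p) (e p) = 1)
    (hww : lor (w p) (w p) = -1) (hwe : lor (w p) (e p) = 0) :
    meanCurvatureVector X p = lor (meanCurvatureVector X p) (e p) • e p
      - lor (meanCurvatureVector X p) (w p) • w p := by
  have hew := (lor_comm (e p) (w p)).trans hwe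
  refine sub_eq_zero.mp (eq_zero_of_orthogonal_adapted_frame hX hs he hw hee hww hwe
    (fun v => ?_) ?_ ?_)
  · simp only [lor_sub_left, lor_smul_left, he v, hw v,
      lor_meanCurvatureVector_differential hX hs p v]
    ring
  · simp only [lor_sub_left, lor_smul_left, hee, hwe]
    ring
  · simp only [lor_sub_left, lor_smul_left, hww, hew]
    ring

/-- Differentiating a hyperbolic rotation of an orthonormal normal frame. -/
theorem lor_differential_boost {e w : M → Mink} {φ : M → ℝ} {p : M}
    (he : MDifferentiableAt 𝓘(ℝ, E2) 𝓘(ℝ, Mink) e p)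
    (hw : MDifferentiableAt 𝓘(ℝ, E2) 𝓘(ℝ, Mink) w p)
    (hφ : MDifferentiableAt 𝓘(ℝ, E2) 𝓘(ℝ, ℝ) φ p)
    (hee : ∀ q, lor (e q) (e q) = 1) (hww : ∀ q, lor (w q) (w q) = -1)
    (hwe : ∀ q, lor (w q) (e q) = 0) (v : TangentSpace 𝓘(ℝ, E2) p) :
    lor (differential (fun q => Real.cosh (φ q) • e q + Real.sinh (φ q) • w q) p v)
        (Real.sinh (φ p) • e p + Real.cosh (φ p) • w p)
      = lor (differential e p v) (w p) - differential φ p v := by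
  have hc : MDifferentiableAt 𝓘(ℝ, E2) 𝓘(ℝ, ℝ) (fun q => Real.cosh (φ q)) p :=
    (Real.differentiable_cosh _).comp_mdifferentiableAt hφ
  have hsh : MDifferentiableAt 𝓘(ℝ, E2) 𝓘(ℝ, ℝ) (fun q => Real.sinh (φ q)) p :=
    (Real.differentiable_sinh _).comp_mdifferentiableAt hφ
  have d1 := differential_smul hc he v
  have d2 := differential_smul hsh hw v
  have d3 := differential_add (f := fun q => Real.cosh (φ q) • e q)
    (g := fun q => Real.sinh (φ q) • w q) (hc.smul he) (hsh.smul hw) v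
  rw [d1, d2, differential_comp_real (Real.hasDerivAt_cosh (φ p)) hφ v,
    differential_comp_real (Real.hasDerivAt_sinh (φ p)) hφ v] at d3
  have k1 := differential_lor he he v
  have k2 := differential_lor hw hw v
  have k3 := differential_lor hw he v
  rw [funext hee, differential_const, lor_comm (e p)] at k1
  rw [funext hww, differential_const, lor_comm (w p)] at k2
  rw [funext hwe, differential_const, lor_comm (w p)] at k3
  rw [d3]
  simp only [lor_add_left, lor_add_right, lor_smul_left, lor_smul_right, hee, hww, hwe,
    lor_comm (e p) (w p)]
  -- The derivatives of cosh φ and sinh φ contribute dφ (sinh φ e + cosh φ w), whose product with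
  -- sinh φ e + cosh φ w is −dφ. By `k1`, `k2`, `k3` the other terms reduce to (cosh² φ − sinh²
  -- φ)⟨de, w⟩.
  have hcs := Real.cosh_sq (φ p)
  generalize Real.cosh (φ p) = C at *
  generalize Real.sinh (φ p) = S at *
  linear_combination (-C * S / 2) * k1 + (-C * S / 2) * k2 - S ^ 2 * k3
    + (lor (differential e p v) (w p) - differential φ p v) * hcs

/-! ### The mean curvature of the projection -/

theorem IsUnitNormalOfProj.lor_differential_left {T₀ : Mink} {X ν : M → Mink}
    (hν : IsUnitNormalOfProj T₀ X ν) (p : M) (v : TangentSpace 𝓘(ℝ, E2) p) :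
    lor (differential ν p v) T₀ = 0 := by
  have h := differential_lor ((hν.smooth p).mdifferentiableAt (by simp))
    (mdifferentiableAt_const (c := T₀)) v
  have e : (fun q => lor (ν q) T₀) = fun _ => (0 : ℝ) := funext hν.mem_slice
  rw [e, differential_const, differential_const, lor_zero_right, add_zero] at h
  exact h.symm

variable [IsManifold 𝓘(ℝ, E2) ∞ M]

/-- The ĝ-trace of h equals its g-trace minus h(∇τ, ∇τ)/L, by the inverse of a rank-one
perturbation. It is checked here as a polynomial identity in the entries of g, dτ and h. -/
theorem projMeanCurvature_mul_lapse {T₀ : Mink} (hT₀ : lor T₀ T₀ = -1) {X ν : M → Mink}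
    (hX : ContMDiff 𝓘(ℝ, E2) 𝓘(ℝ, Mink) ∞ X) (hs : IsSpacelike X)
    (hν : IsUnitNormalOfProj T₀ X ν) (p : M) :
    projMeanCurvature T₀ X ν p * lapse T₀ X p
      = -lor (meanCurvatureVector X p) (ν p) * lapse T₀ X p
        - lor (differential ν p (gradient X (timeFun T₀ X) p))
          (differential X p (gradient X (timeFun T₀ X) p)) := by
  have hc := center_mem_target p
  have hXp := (hX p).mdifferentiableAt (by simp)
  have hτp := (contMDiff_timeFun T₀ hX p).mdifferentiableAt (by simp)
  have hD := (gram_center_pos hX hs p).2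
  have hL := lapse_pos hs T₀ p
  have hh : ∀ i j, lor (differential ν p (coordVec i)) (differential (proj T₀ X) p (coordVec j))
      = lor (differential ν p (coordVec i)) (differential X p (coordVec j)) := by
    intro i j
    have h1 := differential_proj T₀ hXp (coordVec j)
    have h2 := hν.lor_differential_left p (coordVec i)
    rw [h1, lor_sub_right, lor_smul_right, h2, mul_zero, sub_zero]
  have hdet := det_gram_proj hT₀ hX hs hc
  have hcen : (extChartAt 𝓘(ℝ, E2) p).symm (center p) = p := localRep_center id p
  rw [hcen] at hdet
  have hlap := lapse_eq hX hs T₀ p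
  obtain ⟨i00, i01, i10, i11⟩ := invGram_apply X p
  obtain ⟨j00, j01, j10, j11⟩ := invGram_apply (proj T₀ X) p
  rw [lor_meanCurvatureVector hX (hν.lor_differential hX) hν.smooth, differential_gradient,
    differential_gradient]
  simp only [gradDot, Fin.sum_univ_two, i00, i01, i10, i11] at hlap
  simp only [projMeanCurvature, hh, Fin.sum_univ_two, i00, i01, i10, i11, j00, j01, j10, j11, hdet,
    gram_proj hT₀ hX hc, pd_center hτp, lor_add_left, lor_add_right, lor_smul_left, lor_smul_right]
  rw [det_gram] at hD hlap ⊢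
  generalize lapse T₀ X p = L at *
  generalize gram X p (center p) 0 0 = g0 at *
  generalize gram X p (center p) 0 1 = g1 at *
  generalize gram X p (center p) 1 1 = g2 at *
  generalize differential (timeFun T₀ X) p (coordVec 0) = t0 at *
  generalize differential (timeFun T₀ X) p (coordVec 1) = t1 at *
  generalize lor (differential ν p (coordVec 0)) (differential X p (coordVec 0)) = h0 at *
  generalize lor (differential ν p (coordVec 0)) (differential X p (coordVec 1)) = h1 at *
  generalize lor (differential ν p (coordVec 1)) (differential X p (coordVec 0)) = h2 at *
  generalize lor (differential ν p (coordVec 1)) (differential X p (coordVec 1)) = h3 at *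
  have hD' : g0 * g2 - g1 * g1 ≠ 0 := hD.ne'
  have hL' : L ≠ 0 := hL.ne'
  generalize hDD : g0 * g2 - g1 * g1 = D at *
  -- This is det ĝ = L det g written out in coordinates.
  have hq : D * L = D + g2 * (t0 * t0) - 2 * g1 * (t0 * t1) + g0 * (t1 * t1) := by
    rw [hlap]; field_simp; ring
  field_simp
  linear_combination -(g2 * h0 - g1 * (h1 + h2) + g0 * h3) * hq
    - (t1 ^ 2 * h0 - t0 * t1 * (h1 + h2) + t0 ^ 2 * h3) * hDD

/-- The mean curvature of the projected surface in terms of the geometry of the surface. -/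
theorem projMeanCurvature_mul_sqrt_lapse {T₀ : Mink} (hT₀ : lor T₀ T₀ = -1) {X ν : M → Mink}
    (hX : ContMDiff 𝓘(ℝ, E2) 𝓘(ℝ, Mink) ∞ X) (hs : IsSpacelike X)
    (hν : IsUnitNormalOfProj T₀ X ν) (p : M) :
    projMeanCurvature T₀ X ν p * Real.sqrt (lapse T₀ X p)
      = -lor (meanCurvatureVector X p) (ν p) * Real.sqrt (lapse T₀ X p)
        - connForm T₀ X ν p (gradient X (timeFun T₀ X) p) := by
  have hS := Real.sqrt_pos.mpr (lapse_pos hs T₀ p)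
  have hS2 := Real.mul_self_sqrt (lapse_pos hs T₀ p).le
  have key := projMeanCurvature_mul_lapse hT₀ hX hs hν p
  have hfut := futureNormal_eq hX hs (hν.lor_differential hX p) (hν.unit p)
    (isFutureUnitNormal_unitNormalTime hT₀ hX hs hν p)
  -- The derivative of ν is orthogonal to T₀, so only the tangential part ∇τ/√L of the future normal
  -- contributes.
  rw [connForm, hfut, unitNormalTime, lor_smul_right, normalTime, lor_add_right,
    hν.lor_differential_left, zero_add]
  generalize lor (differential ν p (gradient X (timeFun T₀ X) p))
    (differential X p (gradient X (timeFun T₀ X) p)) = h at *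
  rw [← hS2] at key
  generalize Real.sqrt (lapse T₀ X p) = S at *
  field_simp
  linear_combination key

theorem laplacian_timeFun_eq {T₀ : Mink} {X : M → Mink} (hX : ContMDiff 𝓘(ℝ, E2) 𝓘(ℝ, Mink) ∞ X)
    (hs : IsSpacelike X) (p : M) :
    laplacian X (timeFun T₀ X) p
      = -lor (meanCurvatureVector X p) (unitNormalTime T₀ X p) * Real.sqrt (lapse T₀ X p) := by
  have hS := Real.sqrt_pos.mpr (lapse_pos hs T₀ p)
  rw [laplacian_timeFun T₀ hX, unitNormalTime, lor_smul_right, normalTime, lor_add_right,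
    lor_meanCurvatureVector_differential hX hs, add_zero]
  field_simp

end Identities

section Sign

/-! ### Positivity on the space slice -/

/-- Orthogonality to T₀ expresses x₀ times the time component of T₀ as a product of spatial parts.
Cauchy–Schwarz, through Lagrange's identity, then bounds x₀². -/
theorem lor_self_nonneg_of_mem_slice {T₀ x : Mink} (hT₀ : lor T₀ T₀ = -1) (hx : lor x T₀ = 0) :
    0 ≤ lor x x := by
  simp only [lor] at *
  have h1 := sq_nonneg (x 1 * T₀ 2 - x 2 * T₀ 1)
  have h2 := sq_nonneg (x 1 * T₀ 3 - x 3 * T₀ 1)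
  have h3 := sq_nonneg (x 2 * T₀ 3 - x 3 * T₀ 2)
  have e : (x 0 * T₀ 0) ^ 2 = (x 1 * T₀ 1 + x 2 * T₀ 2 + x 3 * T₀ 3) ^ 2 := by
    congr 1; linarith
  have e' : T₀ 0 * T₀ 0 = 1 + T₀ 1 * T₀ 1 + T₀ 2 * T₀ 2 + T₀ 3 * T₀ 3 := by linarith
  have hpos : 0 < T₀ 0 * T₀ 0 := by
    rw [e']
    have := mul_self_nonneg (T₀ 1); have := mul_self_nonneg (T₀ 2); have := mul_self_nonneg (T₀ 3)
    linarith
  have : 0 ≤ T₀ 0 * T₀ 0 * (-(x 0 * x 0) + x 1 * x 1 + x 2 * x 2 + x 3 * x 3) := by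
    have e1 : T₀ 0 * T₀ 0 * (-(x 0 * x 0) + x 1 * x 1 + x 2 * x 2 + x 3 * x 3)
        = T₀ 0 * T₀ 0 * (x 1 * x 1 + x 2 * x 2 + x 3 * x 3) - (x 0 * T₀ 0) ^ 2 := by ring
    rw [e1, e, e']
    nlinarith [mul_self_nonneg (x 1), mul_self_nonneg (x 2), mul_self_nonneg (x 3)]
  exact nonneg_of_mul_nonneg_right this hpos

/-- A maximum of ⟨y, y⟩ on the compact closure exists. It cannot be positive at a point of the open
set Ω, because a slight dilation stays in Ω and increases it; `0 ≤ R` covers the remaining case. -/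
theorem lor_self_le_of_mem_of_frontier {T₀ : Mink} {Ω : Set (spaceSlice T₀)} (hΩ : IsOpen Ω)
    (hb : Bornology.IsBounded Ω) {R : ℝ} (hR : 0 ≤ R)
    (hf : ∀ y ∈ frontier Ω, lor (y : Mink) y ≤ R) {y : spaceSlice T₀} (hy : y ∈ Ω) :
    lor (y : Mink) y ≤ R := by
  have hcont : Continuous fun y : spaceSlice T₀ => lor (y : Mink) y := by
    simp only [← lorL_apply]
    exact (lorL.continuous.comp continuous_subtype_val).clm_apply continuous_subtype_val
  obtain ⟨z, hz, hmax⟩ := hb.isCompact_closure.exists_isMaxOn ⟨y, subset_closure hy⟩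
    hcont.continuousOn
  refine (hmax (subset_closure hy)).trans ?_
  by_cases hzΩ : z ∈ Ω
  · have h1 : ∀ᶠ s : ℝ in 𝓝[>] 1, s • z ∈ Ω := by
      have hc : ContinuousAt (fun s : ℝ => s • z) 1 := by fun_prop
      refine (hc.eventually (hΩ.mem_nhds ?_)).filter_mono nhdsWithin_le_nhds
      simpa using hzΩ
    obtain ⟨s, hs, hs1⟩ := (h1.and self_mem_nhdsWithin).exists
    have hs1' : 1 < s := hs1
    have h2 : lor ((s • z : spaceSlice T₀) : Mink) (s • z : spaceSlice T₀) ≤ lor (z : Mink) z :=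
      hmax (subset_closure hs)
    rw [Submodule.coe_smul, lor_smul_left, lor_smul_right] at h2
    show lor (z : Mink) z ≤ R
    by_contra hcon
    have hpos : 0 < lor (z : Mink) z := by linarith
    have h3 : 0 < (s * s - 1) * lor (z : Mink) z :=
      mul_pos (by nlinarith) hpos
    linarith
  · exact hf z ⟨hz, by rwa [hΩ.interior_eq]⟩

/-- At a point where a curve is farthest from the origin, its velocity is controlled by the shape
operator. -/
theorem lor_velocity_le {G G' n : ℝ → Mink} {g n' : Mink} {c : ℝ}
    (hG : ∀ᶠ t in 𝓝 0, HasDerivAt G (G' t) t) (hG' : HasDerivAt G' g 0) (hn : HasDerivAt n n' 0)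
    (hort : ∀ᶠ t in 𝓝 0, lor (n t) (G' t) = 0) (h0 : G 0 = c • n 0)
    (hmax : IsLocalMax (fun t => lor (G t) (G t)) 0) :
    lor (G' 0) (G' 0) ≤ c * lor n' (G' 0) := by
  have hlor : ∀ {a b : ℝ → Mink} {a' b' : Mink} {t : ℝ}, HasDerivAt a a' t → HasDerivAt b b' t →
      HasDerivAt (fun t => lor (a t) (b t)) (lor a' (b t) + lor (a t) b') t := by
    intro a b a' b' t ha hb
    have h := (lorL.hasFDerivAt_of_bilinear ha.hasFDerivAt hb.hasFDerivAt).hasDerivAt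
    simp only [lorL_apply] at h
    convert! h using 1
    simp [lorL_apply, add_comm]
  have hd : ∀ᶠ t in 𝓝 0, deriv (fun t => lor (G t) (G t)) t = 2 * lor (G' t) (G t) := by
    filter_upwards [hG] with t ht
    rw [(hlor ht ht).deriv, lor_comm (G t)]
    ring
  have hG0 := hG.self_of_nhds
  have hdd : deriv (deriv fun t => lor (G t) (G t)) 0
      = 2 * (lor g (G 0) + lor (G' 0) (G' 0)) := by
    have hd' : (deriv fun t => lor (G t) (G t)) =ᶠ[𝓝 0] fun t => 2 * lor (G' t) (G t) := hd
    rw [hd'.deriv_eq]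
    exact ((hlor hG' hG0).const_mul 2).deriv
  have hng : lor n' (G' 0) + lor (n 0) g = 0 := by
    have h1 := (hlor hn hG').deriv
    have h2 : (fun t => lor (n t) (G' t)) =ᶠ[𝓝 0] fun _ => 0 := hort
    rw [h2.deriv_eq, deriv_const] at h1
    exact h1.symm
  by_contra hcon
  have hpos : 0 < deriv (deriv fun t => lor (G t) (G t)) 0 := by
    rw [hdd, h0, lor_smul_right, lor_comm g]
    push Not at hcon
    have : c * lor (n 0) g = -(c * lor n' (G' 0)) := by linear_combination c * hng
    linarith
  -- A positive second derivative makes 0 a local minimum as well, so the function is locally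
  -- constant and its second derivative vanishes.
  have hmin := isLocalMin_of_deriv_deriv_pos hpos hmax.deriv_eq_zero
    (hlor hG0 hG0).continuousAt
  have hconst : (fun t => lor (G t) (G t)) =ᶠ[𝓝 0] fun _ => lor (G 0) (G 0) := by
    filter_upwards [hmin, hmax] with t h1 h2
    exact le_antisymm h2 h1
  have : (deriv fun t => lor (G t) (G t)) =ᶠ[𝓝 0] fun _ => 0 := by
    have := hconst.deriv
    simpa using this
  rw [this.deriv_eq, deriv_const] at hpos
  exact hpos.false

variable {M : Type*} [TopologicalSpace M] [ChartedSpace E2 M] [IsManifold 𝓘(ℝ, E2) ∞ M]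

theorem lor_differential_proj_le {T₀ : Mink} {X ν : M → Mink}
    (hX : ContMDiff 𝓘(ℝ, E2) 𝓘(ℝ, Mink) ∞ X) (hν : IsUnitNormalOfProj T₀ X ν) {p : M} {c : ℝ}
    (hmax : ∀ q, lor (proj T₀ X q) (proj T₀ X q) ≤ lor (proj T₀ X p) (proj T₀ X p))
    (hc : proj T₀ X p = c • ν p) (v : E2) :
    lor (differential (proj T₀ X) p v) (differential (proj T₀ X) p v)
      ≤ c * lor (differential ν p v) (differential (proj T₀ X) p v) := by
  have hY := contMDiff_proj T₀ hX
  have hct := center_mem_target p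
  let γ : ℝ → E2 := fun t => center p + t • v
  have hγ0 : γ 0 = center p := by simp [γ]
  have hγ : ∀ t, HasDerivAt γ v t := by
    intro t
    have := ((hasDerivAt_id t).smul_const v).const_add (center p)
    rwa [one_smul] at this
  have hev : ∀ᶠ t in 𝓝 (0 : ℝ), γ t ∈ (extChartAt 𝓘(ℝ, E2) p).target := by
    refine (hγ 0).continuousAt.eventually ?_
    rw [hγ0]
    exact (isOpen_extChartAt_target (I := 𝓘(ℝ, E2)) p).mem_nhds hct
  have hYc := contDiffAt_localRep hY hct
  have key := lor_velocity_le (G := fun t => localRep (proj T₀ X) p (γ t))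
    (G' := fun t => fderiv ℝ (localRep (proj T₀ X) p) (γ t) v)
    (n := fun t => localRep ν p (γ t)) (c := c)
    (g := fderiv ℝ (fun u => fderiv ℝ (localRep (proj T₀ X) p) u v) (center p) v)
    (n' := fderiv ℝ (localRep ν p) (center p) v) ?_ ?_ ?_ ?_ ?_ ?_
  · simp only [hγ0] at key
    rw [← differential_eq_fderiv ((hY p).mdifferentiableAt (by simp)),
      ← differential_eq_fderiv ((hν.smooth p).mdifferentiableAt (by simp))] at key
    exact key
  · filter_upwards [hev] with t ht
    exact ((contDiffAt_localRep hY ht).differentiableAt (by simp)).hasFDerivAt.comp_hasDerivAt t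
      (hγ t)
  · have h1 : DifferentiableAt ℝ (fun u => fderiv ℝ (localRep (proj T₀ X) p) u v) (γ 0) := by
      rw [hγ0]
      exact (((hYc.fderiv_right (m := ∞) (by simp)).clm_apply contDiffAt_const).differentiableAt
        (by simp))
    have := h1.hasFDerivAt.comp_hasDerivAt 0 (hγ 0)
    rwa [hγ0] at this
  · have h1 : DifferentiableAt ℝ (localRep ν p) (γ 0) := by
      rw [hγ0]
      exact (contDiffAt_localRep hν.smooth hct).differentiableAt (by simp)
    have := h1.hasFDerivAt.comp_hasDerivAt 0 (hγ 0)
    rwa [hγ0] at this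
  · filter_upwards [hev] with t ht
    rw [fderiv_localRep hY ht]
    exact hν.normal _ _
  · simp only [hγ0, localRep_center, hc]
  -- Even off the chart target `localRep` takes values in the range of `proj T₀ X`, so the bound
  -- holds for all t.
  · refine Filter.Eventually.of_forall fun t => ?_
    simp only [hγ0, localRep_center]
    exact hmax _

end Sign

/-! ### The sign of the mean curvature at a farthest point -/

section MeanCurvatureSign

variable {M : Type*} [TopologicalSpace M] [ChartedSpace E2 M]

theorem differential_linear_combination {V : Type*} [NormedAddCommGroup V] [NormedSpace ℝ V]
    (f : M → V) (p : M) (a b : ℝ) :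
    differential f p (a • coordVec 0 + b • coordVec 1 : E2)
      = a • differential f p (coordVec 0) + b • differential f p (coordVec 1) := by
  have h : ∀ L : E2 →L[ℝ] V, L (a • coordVec 0 + b • coordVec 1)
      = a • L (coordVec 0) + b • L (coordVec 1) := by
    intro L
    rw [map_add, map_smul, map_smul]
  exact h (differential f p)

theorem trace_pos {X n : M → Mink} (hX : ContMDiff 𝓘(ℝ, E2) 𝓘(ℝ, Mink) ∞ X)
    (hs : IsSpacelike X) {p : M}
    (hpos : ∀ v : E2, v ≠ 0 → 0 < lor (differential n p v) (differential X p v)) :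
    0 < ∑ i, ∑ j, invGram X p i j
      * lor (differential n p (coordVec i)) (differential X p (coordVec j)) := by
  obtain ⟨h0, hD⟩ := gram_center_pos hX hs p
  have hc0 : coordVec 0 ≠ 0 := by
    intro h
    have : (coordVec 0) 0 = (0 : E2) 0 := congrArg (fun w : E2 => w 0) h
    simp [coordVec] at this
  have p0 := hpos (coordVec 0) hc0
  -- Testing on the g-orthogonal basis ∂₀, v = −g₀₁∂₀ + g₀₀∂₁: the trace times g₀₀ det g is det g ·
  -- h(∂₀, ∂₀) + h(v, v).
  have p1 := hpos (-gram X p (center p) 0 1 • coordVec 0 + gram X p (center p) 0 0 • coordVec 1) (by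
    intro h
    have : (-gram X p (center p) 0 1 • coordVec 0 + gram X p (center p) 0 0 • coordVec 1 : E2) 1
      = (0 : E2) 1 := congrArg (fun w : E2 => w 1) h
    simp [coordVec] at this
    exact h0.ne' this)
  rw [differential_linear_combination, differential_linear_combination] at p1
  obtain ⟨i00, i01, i10, i11⟩ := invGram_apply X p
  simp only [lor_add_left, lor_add_right, lor_smul_left, lor_smul_right] at p1
  simp only [Fin.sum_univ_two, i00, i01, i10, i11]
  rw [det_gram] at hD ⊢
  generalize gram X p (center p) 0 0 = g0 at *
  generalize gram X p (center p) 0 1 = g1 at *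
  generalize gram X p (center p) 1 1 = g2 at *
  generalize lor (differential n p (coordVec 0)) (differential X p (coordVec 0)) = h0 at *
  generalize lor (differential n p (coordVec 0)) (differential X p (coordVec 1)) = h1 at *
  generalize lor (differential n p (coordVec 1)) (differential X p (coordVec 0)) = h2 at *
  generalize lor (differential n p (coordVec 1)) (differential X p (coordVec 1)) = h3 at *
  have hk : 0 < g0 * (g2 * h0 - g1 * (h1 + h2) + g0 * h3) := by
    have := mul_pos hD p0
    linarith
  have hk' := div_pos (pos_of_mul_pos_right hk (by assumption : (0 : ℝ) < g0).le) hD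
  refine hk'.trans_eq ?_
  ring

variable [IsManifold 𝓘(ℝ, E2) ∞ M]

/-- At a point of the projected surface farthest from the origin the position vector is cν.
Outwardness forces c > 0, and the second derivative test gives c h(v, v) ≥ ĝ(v, v). So h is positive
definite there and its trace −⟨H₀, ν⟩ is positive. -/
theorem exists_lor_meanCurvatureVector_neg [CompactSpace M] [Nonempty M] {T₀ : Mink}
    (hT₀ : lor T₀ T₀ = -1) {X ν : M → Mink} (hX : ContMDiff 𝓘(ℝ, E2) 𝓘(ℝ, Mink) ∞ X)
    (hs : IsSpacelike X) (hν : IsUnitNormalOfProj T₀ X ν) (hout : IsOutward T₀ X ν) :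
    ∃ p, lor (meanCurvatureVector X p) (ν p) < 0 := by
  have hY := contMDiff_proj T₀ hX
  have hYs := isSpacelike_proj hT₀ hX hs
  have hF := contMDiff_lor hY hY
  obtain ⟨p, -, hp⟩ := isCompact_univ.exists_isMaxOn Set.univ_nonempty hF.continuous.continuousOn
  have hmax : ∀ q, lor (proj T₀ X q) (proj T₀ X q) ≤ lor (proj T₀ X p) (proj T₀ X p) :=
    fun q => hp (Set.mem_univ q)
  have hYp := (hY p).mdifferentiableAt (by simp)
  have hslice : ∀ q, lor (proj T₀ X q) T₀ = 0 := by
    intro q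
    rw [proj, timeFun, lor_sub_left, lor_smul_left, hT₀]
    ring
  have hcrit : ∀ v, lor (proj T₀ X p) (differential (proj T₀ X) p v) = 0 := by
    intro v
    have h1 := differential_lor hYp hYp v
    have hloc : IsLocalMax (localRep (fun q => lor (proj T₀ X q) (proj T₀ X q)) p) (center p) := by
      refine Filter.Eventually.of_forall fun u => ?_
      rw [localRep_center]
      exact hmax _
    rw [differential_eq_fderiv ((hF p).mdifferentiableAt (by simp)), hloc.fderiv_eq_zero,
      lor_comm (differential (proj T₀ X) p v)] at h1
    have h2 : (0 : ℝ) = lor (proj T₀ X p) (differential (proj T₀ X) p v)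
      + lor (proj T₀ X p) (differential (proj T₀ X) p v) := h1
    linarith
  set c := lor (proj T₀ X p) (ν p) with hc
  have hνT : lor (ν p) T₀ = 0 := hν.mem_slice p
  have hpos : proj T₀ X p = c • ν p := by
    -- T₀ serves as the time-like unit normal of the projected surface.
    refine sub_eq_zero.mp (eq_zero_of_orthogonal_adapted_frame hY hYs (e := ν p) (w := T₀)
      (hν.normal p) (fun v => ?_) (hν.unit p) hT₀ (by rw [lor_comm, hνT]) (fun v => ?_) ?_ ?_)
    · have hd := differential_proj T₀ ((hX p).mdifferentiableAt (by simp)) v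
      have ht := differential_timeFun T₀ ((hX p).mdifferentiableAt (by simp)) v
      rw [hd, ht, lor_sub_right, lor_smul_right, hT₀, lor_comm T₀]
      ring
    · rw [lor_sub_left, lor_smul_left, hcrit, hν.normal]
      ring
    · rw [lor_sub_left, lor_smul_left, hν.unit, ← hc]
      ring
    · rw [lor_sub_left, lor_smul_left, hνT, hslice]
      ring
  -- For some t > 0 the point (c − t)ν lies in Ω, hence is no farther from the origin than cν: (c −
  -- t)² ≤ c² gives c ≥ t/2.
  have hcpos : 0 < c := by
    obtain ⟨Ω, hΩ, hb, hfr, hev⟩ := hout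
    obtain ⟨t, ⟨⟨y, hy, hyt⟩, -⟩, ht⟩ := ((hev p).and self_mem_nhdsWithin).exists
    have ht' : 0 < t := ht
    have hR := lor_self_nonneg_of_mem_slice hT₀ (hslice p)
    have hle := lor_self_le_of_mem_of_frontier hΩ hb hR (fun z hz => ?_) hy
    · rw [hyt, hpos, ← sub_smul] at hle
      simp only [lor_smul_left, lor_smul_right, hν.unit] at hle
      nlinarith
    · rw [hfr] at hz
      obtain ⟨q, hq⟩ := hz
      rw [← hq]
      exact hmax q
  refine ⟨p, ?_⟩
  have hh : ∀ v : E2, v ≠ 0 → 0 < lor (differential ν p v) (differential X p v) := by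
    intro v hv
    have h1 := lor_differential_proj_le hX hν hmax hpos v
    have h2 := hYs p v hv
    have h3 : lor (differential ν p v) (differential (proj T₀ X) p v)
        = lor (differential ν p v) (differential X p v) := by
      have h4 : lor (differential ν p v) T₀ = 0 := hν.lor_differential_left p v
      have h5 : differential (proj T₀ X) p v
          = differential X p v - (differential (timeFun T₀ X) p v : ℝ) • T₀ :=
        differential_proj T₀ ((hX p).mdifferentiableAt (by simp)) v
      rw [h5, lor_sub_right, lor_smul_right, h4, mul_zero, sub_zero]
    rw [h3] at h1
    exact pos_of_mul_pos_right (h2.trans_le h1) hcpos.le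
  rw [lor_meanCurvatureVector hX (hν.lor_differential hX) hν.smooth]
  exact neg_neg_of_pos (trace_pos hX hs hh)

end MeanCurvatureSign

/-! ### The boosted frame of a space-like mean curvature vector -/

section SpacelikeMeanCurvature

variable {M : Type*} [TopologicalSpace M] [ChartedSpace E2 M]

theorem normH_pos {X : M → Mink}
    (hH : ∀ p, 0 < lor (meanCurvatureVector X p) (meanCurvatureVector X p)) (p : M) :
    0 < normH X p :=
  Real.sqrt_pos.mpr (hH p)

theorem lor_meanCurvatureVector_self {T₀ : Mink} (hT₀ : lor T₀ T₀ = -1) {X ν : M → Mink}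
    (hX : ContMDiff 𝓘(ℝ, E2) 𝓘(ℝ, Mink) ∞ X) (hs : IsSpacelike X)
    (hν : IsUnitNormalOfProj T₀ X ν) (p : M) :
    lor (meanCurvatureVector X p) (meanCurvatureVector X p)
      = lor (meanCurvatureVector X p) (ν p) ^ 2
        - lor (meanCurvatureVector X p) (unitNormalTime T₀ X p) ^ 2 := by
  obtain ⟨h1, h2, h3, -⟩ := isFutureUnitNormal_unitNormalTime hT₀ hX hs hν p
  have e := meanCurvatureVector_eq hX hs (hν.lor_differential hX p) h2 (hν.unit p) h1 h3
  conv_lhs => arg 2; rw [e]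
  rw [lor_sub_right, lor_smul_right, lor_smul_right]
  ring

variable [IsManifold 𝓘(ℝ, E2) ∞ M]

/-- A zero of ⟨H₀, ν⟩ would give |H₀|² = −⟨H₀, w⟩² ≤ 0. On a connected surface the sign found at one
point therefore persists. -/
theorem lor_meanCurvatureVector_neg [CompactSpace M] [ConnectedSpace M] {T₀ : Mink}
    (hT₀ : lor T₀ T₀ = -1) {X ν : M → Mink} (hX : ContMDiff 𝓘(ℝ, E2) 𝓘(ℝ, Mink) ∞ X)
    (hs : IsSpacelike X) (hν : IsUnitNormalOfProj T₀ X ν) (hout : IsOutward T₀ X ν)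
    (hH : ∀ p, 0 < lor (meanCurvatureVector X p) (meanCurvatureVector X p)) (p : M) :
    lor (meanCurvatureVector X p) (ν p) < 0 := by
  obtain ⟨p₀, hp₀⟩ := exists_lor_meanCurvatureVector_neg hT₀ hX hs hν hout
  by_contra hcon
  have hcont := (contMDiff_lor_meanCurvatureVector hX hs (hν.lor_differential hX)
    hν.smooth).continuous
  obtain ⟨q, hq⟩ := mem_range_of_exists_le_of_exists_ge hcont ⟨p₀, hp₀.le⟩ ⟨p, not_lt.mp hcon⟩
  have hq' : lor (meanCurvatureVector X q) (ν q) = 0 := hq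
  have h1 := hH q
  rw [lor_meanCurvatureVector_self hT₀ hX hs hν, hq'] at h1
  nlinarith [sq_nonneg (lor (meanCurvatureVector X q) (unitNormalTime T₀ X q))]

theorem angle_eq {T₀ : Mink} {X : M → Mink} (hX : ContMDiff 𝓘(ℝ, E2) 𝓘(ℝ, Mink) ∞ X)
    (hs : IsSpacelike X) (p : M) :
    angle T₀ X p
      = Real.arsinh (lor (meanCurvatureVector X p) (unitNormalTime T₀ X p) / normH X p) := by
  have hS := Real.sqrt_pos.mpr (lapse_pos hs T₀ p)
  rw [angle, laplacian_timeFun_eq hX hs, neg_mul, neg_neg, mul_div_mul_right _ _ hS.ne']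

/-- θ is a smooth function of the two components of H₀ along ν and w, whose smoothness is already
known, on the region where the first dominates the second. -/
theorem contMDiff_angle {T₀ : Mink} (hT₀ : lor T₀ T₀ = -1) {X ν : M → Mink}
    (hX : ContMDiff 𝓘(ℝ, E2) 𝓘(ℝ, Mink) ∞ X) (hs : IsSpacelike X)
    (hν : IsUnitNormalOfProj T₀ X ν)
    (hH : ∀ p, 0 < lor (meanCurvatureVector X p) (meanCurvatureVector X p)) :
    ContMDiff 𝓘(ℝ, E2) 𝓘(ℝ, ℝ) ∞ (angle T₀ X) := by
  have ha := contMDiff_lor_meanCurvatureVector hX hs (hν.lor_differential hX) hν.smooth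
  have hb := contMDiff_lor_meanCurvatureVector hX hs
    (fun p => (isFutureUnitNormal_unitNormalTime hT₀ hX hs hν p).2.1)
    (contMDiff_unitNormalTime T₀ hX hs)
  intro p
  have hd : ContDiffAt ℝ ∞ (fun z : ℝ × ℝ => Real.arsinh (z.2 / Real.sqrt (z.1 ^ 2 - z.2 ^ 2)))
      (lor (meanCurvatureVector X p) (ν p),
        lor (meanCurvatureVector X p) (unitNormalTime T₀ X p)) := by
    have hp := hH p
    rw [lor_meanCurvatureVector_self hT₀ hX hs hν] at hp
    refine Real.contDiff_arsinh.contDiffAt.comp _ (contDiffAt_snd.div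
      (((contDiffAt_fst.pow 2).sub (contDiffAt_snd.pow 2)).sqrt hp.ne') ?_)
    exact (Real.sqrt_pos.mpr hp).ne'
  have hcomp := ContDiffAt.comp_contMDiffAt (x := p) (f := fun q => (lor (meanCurvatureVector X q)
    (ν q), lor (meanCurvatureVector X q) (unitNormalTime T₀ X q))) hd ((ha p).prodMk_space (hb p))
  refine hcomp.congr_of_eventuallyEq (Filter.Eventually.of_forall fun q => ?_)
  rw [angle_eq hX hs, normH, lor_meanCurvatureVector_self hT₀ hX hs hν]
  rfl

theorem sinh_angle {T₀ : Mink} {X : M → Mink} (hX : ContMDiff 𝓘(ℝ, E2) 𝓘(ℝ, Mink) ∞ X)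
    (hs : IsSpacelike X) (p : M) :
    Real.sinh (angle T₀ X p)
      = lor (meanCurvatureVector X p) (unitNormalTime T₀ X p) / normH X p := by
  rw [angle_eq hX hs, Real.sinh_arsinh]

/-- From cosh² = 1 + sinh² only the square is determined; `hneg` selects the root. -/
theorem cosh_angle {T₀ : Mink} (hT₀ : lor T₀ T₀ = -1) {X ν : M → Mink}
    (hX : ContMDiff 𝓘(ℝ, E2) 𝓘(ℝ, Mink) ∞ X) (hs : IsSpacelike X)
    (hν : IsUnitNormalOfProj T₀ X ν)
    (hH : ∀ p, 0 < lor (meanCurvatureVector X p) (meanCurvatureVector X p)) {p : M}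
    (hneg : lor (meanCurvatureVector X p) (ν p) < 0) :
    Real.cosh (angle T₀ X p) = -lor (meanCurvatureVector X p) (ν p) / normH X p := by
  have hN := normH_pos hH p
  have hN2 : normH X p ^ 2 = _ := Real.sq_sqrt (hH p).le
  rw [lor_meanCurvatureVector_self hT₀ hX hs hν] at hN2
  rw [angle_eq hX hs, Real.cosh_arsinh, Real.sqrt_eq_iff_mul_self_eq_of_pos
    (div_pos (neg_pos.mpr hneg) hN)]
  field_simp
  linarith

theorem e3H_eq {T₀ : Mink} (hT₀ : lor T₀ T₀ = -1) {X ν : M → Mink}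
    (hX : ContMDiff 𝓘(ℝ, E2) 𝓘(ℝ, Mink) ∞ X) (hs : IsSpacelike X)
    (hν : IsUnitNormalOfProj T₀ X ν)
    (hH : ∀ p, 0 < lor (meanCurvatureVector X p) (meanCurvatureVector X p)) {p : M}
    (hneg : lor (meanCurvatureVector X p) (ν p) < 0) :
    e3H X p
        = Real.cosh (angle T₀ X p) • ν p + Real.sinh (angle T₀ X p) • unitNormalTime T₀ X p := by
  obtain ⟨h1, h2, h3, -⟩ := isFutureUnitNormal_unitNormalTime hT₀ hX hs hν p
  have e := meanCurvatureVector_eq hX hs (hν.lor_differential hX p) h2 (hν.unit p) h1 h3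
  rw [cosh_angle hT₀ hX hs hν hH hneg, sinh_angle hX hs]
  ext k
  have ek := congrFun e k
  simp only [e3H, Pi.neg_apply, Pi.smul_apply, Pi.add_apply, Pi.sub_apply, smul_eq_mul] at ek ⊢
  rw [ek]
  ring

/-- The boost by θ takes (ν, w) to an orthonormal frame starting with `e3H`, and its second vector
sinh θ ν + cosh θ w remains future-directed because ν is orthogonal to T₀. -/
theorem connForm_e3H {T₀ : Mink} (hT₀ : lor T₀ T₀ = -1) {X ν : M → Mink}
    (hX : ContMDiff 𝓘(ℝ, E2) 𝓘(ℝ, Mink) ∞ X) (hs : IsSpacelike X)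
    (hν : IsUnitNormalOfProj T₀ X ν)
    (hH : ∀ p, 0 < lor (meanCurvatureVector X p) (meanCurvatureVector X p))
    (hneg : ∀ p, lor (meanCurvatureVector X p) (ν p) < 0) (p : M)
    (v : TangentSpace 𝓘(ℝ, E2) p) :
    connForm T₀ X (e3H X) p v = connForm T₀ X ν p v - differential (angle T₀ X) p v := by
  have hw := isFutureUnitNormal_unitNormalTime hT₀ hX hs hν
  obtain ⟨h1, h2, h3, h4⟩ := hw p
  have hνn := hν.lor_differential hX p
  have he : e3H X = fun q => Real.cosh (angle T₀ X q) • ν q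
      + Real.sinh (angle T₀ X q) • unitNormalTime T₀ X q :=
    funext fun q => e3H_eq hT₀ hX hs hν hH (hneg q)
  have hsq := Real.cosh_sq (angle T₀ X p)
  have hew := (lor_comm (ν p) _).trans h3
  have hνT : lor (ν p) T₀ = 0 := hν.mem_slice p
  have f1 : futureNormal T₀ X ν p = unitNormalTime T₀ X p :=
    futureNormal_eq hX hs hνn (hν.unit p) (hw p)
  have f2 : futureNormal T₀ X (e3H X) p = Real.sinh (angle T₀ X p) • ν p
      + Real.cosh (angle T₀ X p) • unitNormalTime T₀ X p := by
    rw [he]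
    refine futureNormal_eq hX hs (fun v => ?_) ?_ ⟨?_, fun v => ?_, ?_, ?_⟩
    · simp only [lor_add_left, lor_smul_left, hνn v, h2 v]
      ring
    · simp only [lor_add_left, lor_smul_left, lor_add_right, lor_smul_right, hν.unit, h1, h3, hew]
      linear_combination hsq
    · simp only [lor_add_left, lor_smul_left, lor_add_right, lor_smul_right, hν.unit, h1, h3, hew]
      linear_combination -hsq
    · simp only [lor_add_left, lor_smul_left, hνn v, h2 v]
      ring
    · simp only [lor_add_left, lor_smul_left, lor_add_right, lor_smul_right, hν.unit, h1, h3, hew]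
      ring
    · simp only [lor_add_left, lor_smul_left, hνT]
      have := mul_neg_of_pos_of_neg (Real.cosh_pos (angle T₀ X p)) h4
      linarith
  rw [connForm, connForm, f1, f2, he]
  exact lor_differential_boost ((hν.smooth p).mdifferentiableAt (by simp))
    ((contMDiff_unitNormalTime T₀ hX hs p).mdifferentiableAt (by simp))
    ((contMDiff_angle hT₀ hX hs hν hH p).mdifferentiableAt (by simp)) hν.unit
    (fun q => (hw q).1) (fun q => (hw q).2.2.1) v

/-- The w-component of H₀ cancels between (Δτ)² and |H₀|² L, leaving L⟨H₀, ν⟩². -/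
theorem sqrt_laplacian_sq_add {T₀ : Mink} (hT₀ : lor T₀ T₀ = -1) {X ν : M → Mink}
    (hX : ContMDiff 𝓘(ℝ, E2) 𝓘(ℝ, Mink) ∞ X) (hs : IsSpacelike X)
    (hν : IsUnitNormalOfProj T₀ X ν)
    (hH : ∀ p, 0 < lor (meanCurvatureVector X p) (meanCurvatureVector X p)) {p : M}
    (hneg : lor (meanCurvatureVector X p) (ν p) < 0) :
    Real.sqrt (laplacian X (timeFun T₀ X) p ^ 2 + normH X p ^ 2 * lapse T₀ X p)
      = -lor (meanCurvatureVector X p) (ν p) * Real.sqrt (lapse T₀ X p) := by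
  have hN2 : normH X p ^ 2 = _ := Real.sq_sqrt (hH p).le
  have hS2 := Real.sq_sqrt (lapse_pos hs T₀ p).le
  rw [Real.sqrt_eq_iff_mul_self_eq_of_pos
    (mul_pos (neg_pos.mpr hneg) (Real.sqrt_pos.mpr (lapse_pos hs T₀ p))), hN2,
    lor_meanCurvatureVector_self hT₀ hX hs hν, laplacian_timeFun_eq hX hs]
  nth_rw 4 [← hS2]
  ring

/-! ### The integral identities -/

variable [MeasurableSpace M] [BorelSpace M]

theorem integral_projMeanCurvature {T₀ : Mink} (hT₀ : lor T₀ T₀ = -1) {X ν : M → Mink}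
    (hX : ContMDiff 𝓘(ℝ, E2) 𝓘(ℝ, Mink) ∞ X) (hs : IsSpacelike X)
    (hν : IsUnitNormalOfProj T₀ X ν) :
    ∫ p, projMeanCurvature T₀ X ν p ∂(area (proj T₀ X))
      = ∫ p, (-lor (meanCurvatureVector X p) (ν p) * Real.sqrt (lapse T₀ X p)
        - connForm T₀ X ν p (gradient X (timeFun T₀ X) p)) ∂(area X) := by
  rw [integral_area_proj hT₀ hX hs]
  exact integral_congr_ae
    (.of_forall fun p => projMeanCurvature_mul_sqrt_lapse hT₀ hX hs hν p)

theorem integral_projMeanCurvature_of_isOutward [CompactSpace M] [ConnectedSpace M] {T₀ : Mink}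
    (hT₀ : lor T₀ T₀ = -1) {X ν : M → Mink} (hX : ContMDiff 𝓘(ℝ, E2) 𝓘(ℝ, Mink) ∞ X)
    (hs : IsSpacelike X) (hν : IsUnitNormalOfProj T₀ X ν) (hout : IsOutward T₀ X ν)
    (hH : ∀ p, 0 < lor (meanCurvatureVector X p) (meanCurvatureVector X p)) :
    ∫ p, projMeanCurvature T₀ X ν p ∂(area (proj T₀ X))
      = ∫ p, (Real.sqrt (laplacian X (timeFun T₀ X) p ^ 2 + normH X p ^ 2 * lapse T₀ X p)
        - dot X p (gradient X (angle T₀ X) p) (gradient X (timeFun T₀ X) p)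
        - connForm T₀ X (e3H X) p (gradient X (timeFun T₀ X) p)) ∂(area X) := by
  refine (integral_projMeanCurvature hT₀ hX hs hν).trans
    (integral_congr_ae (.of_forall fun p => ?_))
  have hneg := lor_meanCurvatureVector_neg hT₀ hX hs hν hout hH
  simp only [connForm_e3H hT₀ hX hs hν hH hneg, dot_gradient hX hs,
    sqrt_laplacian_sq_add hT₀ hX hs hν hH (hneg p)]
  ring

end SpacelikeMeanCurvature

end MinkowskiSurface

theorem mainTheorem7 {M : Type*} [TopologicalSpace M] [ChartedSpace MinkowskiSurface.E2 M]
    [IsManifold 𝓘(ℝ, MinkowskiSurface.E2) ∞ M] [T2Space M] [CompactSpace M] [ConnectedSpace M]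
    [MeasurableSpace M] [BorelSpace M]
    (T₀ : MinkowskiSurface.Mink) (hT₀ : MinkowskiSurface.lor T₀ T₀ = -1)
    (X : M → MinkowskiSurface.Mink)
    (hX : ContMDiff 𝓘(ℝ, MinkowskiSurface.E2) 𝓘(ℝ, MinkowskiSurface.Mink) ∞ X)
    (hspace : MinkowskiSurface.IsSpacelike X)
    (ν : M → MinkowskiSurface.Mink) (hν : MinkowskiSurface.IsUnitNormalOfProj T₀ X ν) :
    (∫ p, MinkowskiSurface.projMeanCurvature T₀ X ν p
        ∂(MinkowskiSurface.area (MinkowskiSurface.proj T₀ X))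
      = ∫ p, (-MinkowskiSurface.lor (MinkowskiSurface.meanCurvatureVector X p) (ν p)
            * Real.sqrt (MinkowskiSurface.lapse T₀ X p)
          - MinkowskiSurface.connForm T₀ X ν p
              (MinkowskiSurface.gradient X (MinkowskiSurface.timeFun T₀ X) p))
          ∂(MinkowskiSurface.area X)) ∧
    (MinkowskiSurface.IsOutward T₀ X ν →
      (∀ p, 0 < MinkowskiSurface.lor (MinkowskiSurface.meanCurvatureVector X p)
        (MinkowskiSurface.meanCurvatureVector X p)) →
      ∫ p, MinkowskiSurface.projMeanCurvature T₀ X ν p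
          ∂(MinkowskiSurface.area (MinkowskiSurface.proj T₀ X))
        = ∫ p, (Real.sqrt (MinkowskiSurface.laplacian X (MinkowskiSurface.timeFun T₀ X) p ^ 2
                + MinkowskiSurface.normH X p ^ 2 * MinkowskiSurface.lapse T₀ X p)
            - MinkowskiSurface.dot X p
                (MinkowskiSurface.gradient X (MinkowskiSurface.angle T₀ X) p)
                (MinkowskiSurface.gradient X (MinkowskiSurface.timeFun T₀ X) p)
            - MinkowskiSurface.connForm T₀ X (MinkowskiSurface.e3H X) p
                (MinkowskiSurface.gradient X (MinkowskiSurface.timeFun T₀ X) p))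
            ∂(MinkowskiSurface.area X)) :=
  ⟨MinkowskiSurface.integral_projMeanCurvature hT₀ hX hspace hν,
    MinkowskiSurface.integral_projMeanCurvature_of_isOutward hT₀ hX hspace hν⟩
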